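/- \textbf{Setting.} A partition of $[0,1]$ is a finite set of points $0=t_0<t_1<\dots<t_N=1$; its number of intervals is denoted $N$, and the lengths of its largest and smallest interval are denoted $|\cdot|$ and $\underline{\,\cdot\,}$. Let $\pi=(\pi^n)_{n\ge 0}$ with $\pi^n=(0=t^n_0<\dots<t^n_{N(\pi^n)}=1)$ be a sequence of partitions, where $\pi^0=\{0,1\}$. It is \emph{finitely refining (with vanishing mesh)} if $\pi^m\subseteq\pi^n$ for $m\le n$, $|\pi^n|\to0$, and there is $M<\infty$ such that for all $n$ at most $M$ points of $\pi^{n+1}$ lie between two consecutive points of $\pi^n$. It is \emph{complete refining} if there are $\varepsilon,M>0$ with $1+\varepsilon\le|\pi^n|/|\pi^{n+1}|\le M$ for all $n\ge1$, and \emph{balanced} if there is $c>0$ with $|\pi^n|/\underline{\pi^n}\le c$ for all $n\ge1$. For $m\ge0$ and $0\le k<N(\pi^m)$ let $p(m,k)=\min\{j: t^{m+1}_j\ge t^m_k\}$. For $2\le i\le p(m,k+1)-p(m,k)$ put $t_1=t^{m+1}_{p(m,k)}$, $t_2=t^{m+1}_{p(m,k)+i-1}$, $t_3=t^{m+1}_{p(m,k)+i}$.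 The Haar function $\psi_{m,k,i}$ equals $\sqrt{\frac{t_3-t_2}{(t_2-t_1)(t_3-t_1)}}$ on $[t_1,t_2)$, $-\sqrt{\frac{t_2-t_1}{(t_3-t_2)(t_3-t_1)}}$ on $[t_2,t_3)$ and $0$ elsewhere, and the Schauder function is $e^\pi_{m,k,i}(t)=\int_0^t\psi_{m,k,i}(s)\,ds$. Each level $m$ has $N(\pi^{m+1})-N(\pi^m)$ labels $(k,i)$. For $x:[0,1]\to\mathbb R$ let $[x]_{\pi^n}(t)=\sum_{j=0}^{N(\pi^n)-1}\big(x(t^n_{j+1}\wedge t)-x(t^n_j\wedge t)\big)^2$. A càdlàg path $x$ belongs to $Q_\pi([0,1],\mathbb R)$ if the measures $\sum_{j}(x(t^n_{j+1})-x(t^n_j))^2\delta_{t^n_j}$ converge weakly on $[0,1]$ to a finite measure $\mu$ such that $t\mapsto\mu([0,t])-\sum_{0<s\le t}|\Delta x(s)|^2$ is continuous and non-decreasing; its quadratic variation is then $[x]_\pi(t)=\mu([0,t])=\lim_n[x]_{\pi^n}(t)$ for $t\in[0,1]$. \textbf{Theorem.} Let $\pi$ be finitely refining with vanishing mesh. Let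 $(\eta_a)$ be real random variables on a probability space $(\Omega,\mathcal F,\mathbb P)$, indexed by the labels $a=(m,k,i)$, such that for all labels $a,b$ $$\mathbb E\,\eta_a=0,\qquad \mathbb E\,\eta_a\eta_b=\mathbf 1_{a=b},\qquad \sup_a\mathbb E\,\eta_a^4<\infty,$$ and such that for all pairwise distinct labels $a,b,c,d$ and all integers $\alpha,\beta,\gamma,\delta\ge0$ with $\alpha+\beta+\gamma+\delta=4$ $$\mathbb E(\eta_a^\alpha\eta_b^\beta\eta_c^\gamma\eta_d^\delta)=\mathbb E(\eta_a^\alpha)\,\mathbb E(\eta_b^\beta)\,\mathbb E(\eta_c^\gamma)\,\mathbb E(\eta_d^\delta).$$ Let $(x(t))_{t\in[0,1]}$ be a real-valued process such that almost surely, for all $t\in[0,1]$, $$x(t)=x(0)+(x(1)-x(0))\,t+\sum_{m=0}^\infty\ \sum_{k,i}\eta_{m,k,i}\,e^\pi_{m,k,i}(t),$$ where the inner sum runs over the finitely many labels of level $m$ and the outer series converges in the order $m=0,1,2,\dots$. Then for every $t\in[0,1]$ and every $\varepsilon>0$ $$\lim_{n\to\infty}\mathbb P\big(|[x]_{\pi^n}(t)-t|>\varepsilon\big)=0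 .$$ If moreover $\pi$ is complete refining and balanced, then almost surely $x\in Q_\pi([0,1],\mathbb R)$ and $[x]_\pi(t)=t$ for all $t\in[0,1]$. -/

import Mathlib

open MeasureTheory Filter Topology Set

noncomputable section

namespace SchauderQV

/-- A finite partition `0 = t 0 < t 1 < ⋯ < t N = 1` of `[0, 1]`; `t j` is meaningful for `j ≤ N`
only. -/
structure UnitPartition where
  N : ℕ
  t : ℕ → ℝ
  t_zero : t 0 = 0
  t_last : t N = 1
  strictMonoOn : StrictMonoOn t (Set.Iic N)

/-- The set of points of a partition. -/
def UnitPartition.points (p : UnitPartition) : Set ℝ := p.t '' Set.Iic p.N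

/-- The length of the largest interval. -/
def UnitPartition.mesh (p : UnitPartition) : ℝ := ⨆ j : Fin p.N, (p.t (j + 1) - p.t j)

/-- The length of the smallest interval. -/
def UnitPartition.minMesh (p : UnitPartition) : ℝ := ⨅ j : Fin p.N, (p.t (j + 1) - p.t j)

/-- The sequence of partitions is nested. -/
def Refining (π : ℕ → UnitPartition) : Prop :=
  ∀ m n, m ≤ n → (π m).points ⊆ (π n).points

/-- Nested, with vanishing mesh, and with a uniformly bounded number of points of `π (n + 1)`
between two consecutive points of `π n`. -/
def FinitelyRefining (π : ℕ → UnitPartition) : Prop :=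
  Refining π ∧ Tendsto (fun n => (π n).mesh) atTop (𝓝 0) ∧
    ∃ M : ℕ, ∀ n, ∀ k < (π n).N,
      ((π (n + 1)).points ∩ Set.Icc ((π n).t k) ((π n).t (k + 1))).ncard ≤ M

/-- All intervals of `π n` are comparable, uniformly in `n ≥ 1`. -/
def Balanced (π : ℕ → UnitPartition) : Prop :=
  ∃ c : ℝ, 0 < c ∧ ∀ n, 1 ≤ n → (π n).mesh / (π n).minMesh ≤ c

def CompleteRefining (π : ℕ → UnitPartition) : Prop :=
  ∃ ε M : ℝ, 0 < ε ∧ 0 < M ∧ ∀ n, 1 ≤ n →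
    1 + ε ≤ (π n).mesh / (π (n + 1)).mesh ∧ (π n).mesh / (π (n + 1)).mesh ≤ M

/-- The position in `π (n + 1)` of the `k`-th point of `π n`. -/
def pos (π : ℕ → UnitPartition) (n k : ℕ) : ℕ :=
  sInf {j : ℕ | j ≤ (π (n + 1)).N ∧ (π n).t k ≤ (π (n + 1)).t j}

/-- The labels `(m, k, i)` of the Haar functions. The value `i = 1`, for which the interval
where the Haar function is positive would be empty, is not a label, so level `m` has
`N (π (m + 1)) - N (π m)` labels. -/
def labels (π : ℕ → UnitPartition) : Set (ℕ × ℕ × ℕ) :=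
  {a | a.2.1 < (π a.1).N ∧ 2 ≤ a.2.2 ∧ a.2.2 ≤ pos π a.1 (a.2.1 + 1) - pos π a.1 a.2.1}

/-- The Haar function `ψ_{m,k,i}`: with `t₁ = t^{m+1}_{p(m,k)}`, `t₂ = t^{m+1}_{p(m,k)+i-1}`
and `t₃ = t^{m+1}_{p(m,k)+i}`, it is a positive constant on `[t₁, t₂)`, a negative constant
on `[t₂, t₃)`, and zero elsewhere. -/
def haar (π : ℕ → UnitPartition) (m k i : ℕ) (s : ℝ) : ℝ :=
  let t₁ := (π (m + 1)).t (pos π m k)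
  let t₂ := (π (m + 1)).t (pos π m k + i - 1)
  let t₃ := (π (m + 1)).t (pos π m k + i)
  (Set.Ico t₁ t₂).indicator (fun _ => √((t₃ - t₂) / (t₂ - t₁) * (1 / (t₃ - t₁)))) s
    - (Set.Ico t₂ t₃).indicator (fun _ => √((t₂ - t₁) / (t₃ - t₂) * (1 / (t₃ - t₁)))) s

/-- The Schauder function `e_{m,k,i}`. -/
def schauder (π : ℕ → UnitPartition) (m k i : ℕ) (t : ℝ) : ℝ :=
  ∫ s in (0 : ℝ)..t, haar π m k i s

/-- The sum of the levels `m < n` of the Schauder series with coefficients `θ`. -/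
def schauderSum (π : ℕ → UnitPartition) (θ : ℕ × ℕ × ℕ → ℝ) (n : ℕ) (t : ℝ) : ℝ :=
  ∑ m ∈ Finset.range n, ∑ k ∈ Finset.range (π m).N,
    ∑ i ∈ Finset.Icc 2 (pos π m (k + 1) - pos π m k), θ (m, k, i) * schauder π m k i t

/-- `x(t) = x(0) + (x(1) - x(0)) t + ∑_m ∑_k θ_{m,k} e_{m,k}(t)` for all `t ∈ [0, 1]`. -/
def HasSchauderExpansion (π : ℕ → UnitPartition) (θ : ℕ × ℕ × ℕ → ℝ) (x : ℝ → ℝ) : Prop :=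
  ∀ t ∈ Set.Icc (0 : ℝ) 1,
    Tendsto (fun n => x 0 + (x 1 - x 0) * t + schauderSum π θ n t) atTop (𝓝 (x t))

/-- The quadratic variation of `x` at time `t` along one partition. -/
def levelQV (p : UnitPartition) (x : ℝ → ℝ) (t : ℝ) : ℝ :=
  ∑ j ∈ Finset.range p.N, (x (min (p.t (j + 1)) t) - x (min (p.t j) t)) ^ 2

/-- The measure `∑_j (x(t_{j+1}) - x(t_j))² δ_{t_j}` on `[0, 1]`. -/
def qvMeasure (p : UnitPartition) (x : ℝ → ℝ) : FiniteMeasure (Set.Icc (0 : ℝ) 1) :=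
  ∑ j ∈ Finset.range p.N, Real.toNNReal ((x (p.t (j + 1)) - x (p.t j)) ^ 2) •
    (diracProba (Set.projIcc (0 : ℝ) 1 zero_le_one (p.t j))).toFiniteMeasure

/-- Right-continuous with left limits on `[0, 1]`. -/
def IsCadlag (x : ℝ → ℝ) : Prop :=
  (∀ t ∈ Set.Ico (0 : ℝ) 1, Tendsto x (𝓝[>] t) (𝓝 (x t))) ∧
    ∀ t ∈ Set.Ioc (0 : ℝ) 1, ∃ l, Tendsto x (𝓝[<] t) (𝓝 l)

/-- The jump of `x` at `s`. -/
def jump (x : ℝ → ℝ) (s : ℝ) : ℝ := x s - Function.leftLim x s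

/-- The path `x` has finite quadratic variation along `π`, and its quadratic variation is the
function `q` on `[0, 1]`. -/
def HasQuadraticVariation (π : ℕ → UnitPartition) (x q : ℝ → ℝ) : Prop :=
  IsCadlag x ∧ ∃ μ : FiniteMeasure (Set.Icc (0 : ℝ) 1),
    Tendsto (fun n => qvMeasure (π n) x) atTop (𝓝 μ) ∧
    Summable (fun s : Set.Ioc (0 : ℝ) 1 => jump x s ^ 2) ∧
    (Continuous fun t : Set.Icc (0 : ℝ) 1 =>
      (μ (Set.Iic t) : ℝ) - ∑' s : Set.Ioc (0 : ℝ) (t : ℝ), jump x s ^ 2) ∧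
    (Monotone fun t : Set.Icc (0 : ℝ) 1 =>
      (μ (Set.Iic t) : ℝ) - ∑' s : Set.Ioc (0 : ℝ) (t : ℝ), jump x s ^ 2) ∧
    ∀ t : Set.Icc (0 : ℝ) 1, q t = μ (Set.Iic t) ∧
      Tendsto (fun n => levelQV (π n) x t) atTop (𝓝 (q t))

/-- The class `Q_π([0, 1], ℝ)` of paths with finite quadratic variation along `π`. -/
def finiteQV (π : ℕ → UnitPartition) : Set (ℝ → ℝ) := {x | ∃ q, HasQuadraticVariation π x q}

/-- The conditions on the random coefficients: random variables that are centred and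
orthonormal, with bounded fourth moments, for which the mixed moments of order four of distinct
coefficients factorise. -/
structure AdmissibleCoefficients {Ω : Type*} [MeasurableSpace Ω] (P : Measure Ω)
    (π : ℕ → UnitPartition) (η : ℕ × ℕ × ℕ → Ω → ℝ) : Prop where
  aemeasurable : ∀ a ∈ labels π, AEMeasurable (η a) P
  integrable_pow_four : ∀ a ∈ labels π, Integrable (fun ω => η a ω ^ 4) P
  bounded_fourth_moment : ∃ M : ℝ, ∀ a ∈ labels π, ∫ ω, η a ω ^ 4 ∂P ≤ M
  centred : ∀ a ∈ labels π, ∫ ω, η a ω ∂P = 0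
  orthonormal : ∀ a ∈ labels π, ∀ b ∈ labels π,
    ∫ ω, η a ω * η b ω ∂P = if a = b then 1 else 0
  factorisation : ∀ a ∈ labels π, ∀ b ∈ labels π, ∀ c ∈ labels π, ∀ d ∈ labels π,
    [a, b, c, d].Nodup → ∀ α β γ δ : ℕ, α + β + γ + δ = 4 →
      ∫ ω, η a ω ^ α * η b ω ^ β * η c ω ^ γ * η d ω ^ δ ∂P =
        (∫ ω, η a ω ^ α ∂P) * (∫ ω, η b ω ^ β ∂P) * (∫ ω, η c ω ^ γ ∂P) * (∫ ω, η d ω ^ δ ∂P)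

end SchauderQV

end

/-! Up to its affine part, `x` has the second-order structure of a Brownian bridge. The Haar
functions of the levels below `n`, together with the constant, form an orthonormal basis of the step
functions on `π n`. Parseval's identity (`parseval`, a telescoping of energies) shows that the
increments of the Schauder series over cells of `π n` have covariance `δ_{jl} len_j - len_j len_l`
(`sum_schauderIncr_mul`). All levels from `n` on vanish at the points of `π n`, so these increments
are finite linear forms in the coefficients.

The sum of their squares is a quadratic form. Because moments of order four factorise, its variance
is at most a constant times the squared Hilbert–Schmidt norm of its kernel
(`integral_quadraticForm_sq_le`), which Parseval bounds by twice the mesh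
(`integral_bridgeQV_sub_sq_le`). Along a sequence of summable meshes this gives almost sure
convergence; convergence in probability follows by passing to sub-subsequences. No moments of `x 1 -
x 0` are assumed, so the affine part is removed pathwise by Cauchy–Schwarz (`tendsto_fullQV`); the
cell cut by `t` is controlled by Bessel's inequality and Fatou's lemma.

Complete refining makes the meshes geometric, so no subsequence is needed, and monotonicity in `t`
extends convergence from rational times to all times. Fourth moments of the level sums, with balance
to count the partition points, make the series converge uniformly (`ae_eventually_levelSum_le`).
Paths are then continuous, there are no jumps, and convergence of distribution functions yields weak
convergence to Lebesgue measure. -/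

noncomputable section

namespace SchauderQV

/-! ### Elementary facts on partitions of the unit interval -/

namespace UnitPartition

variable (p : UnitPartition)

theorem t_le_t {i j : ℕ} (hij : i ≤ j) (hj : j ≤ p.N) : p.t i ≤ p.t j :=
  p.strictMonoOn.monotoneOn (mem_Iic.2 (hij.trans hj)) (mem_Iic.2 hj) hij

theorem t_lt_t {i j : ℕ} (hij : i < j) (hj : j ≤ p.N) : p.t i < p.t j :=
  p.strictMonoOn (mem_Iic.2 (hij.le.trans hj)) (mem_Iic.2 hj) hij

theorem t_nonneg {j : ℕ} (hj : j ≤ p.N) : 0 ≤ p.t j := by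
  simpa [p.t_zero] using p.t_le_t (Nat.zero_le j) hj

theorem t_le_one {j : ℕ} (hj : j ≤ p.N) : p.t j ≤ 1 := by
  simpa [p.t_last] using p.t_le_t hj le_rfl

theorem t_mem_Icc {j : ℕ} (hj : j ≤ p.N) : p.t j ∈ Icc (0 : ℝ) 1 :=
  ⟨p.t_nonneg hj, p.t_le_one hj⟩

theorem N_pos : 0 < p.N := by
  by_contra! h
  have h0 : p.N = 0 := by omega
  have h1 := p.t_last
  rw [h0, p.t_zero] at h1
  exact zero_ne_one h1

/-- The length of the `j`-th interval. -/
def len (j : ℕ) : ℝ := p.t (j + 1) - p.t j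

theorem len_pos {j : ℕ} (hj : j < p.N) : 0 < p.len j :=
  sub_pos.2 (p.t_lt_t (Nat.lt_succ_self j) hj)

theorem len_le_mesh {j : ℕ} (hj : j < p.N) : p.len j ≤ p.mesh :=
  le_ciSup (f := fun j : Fin p.N => p.t (j + 1) - p.t j) (finite_range _).bddAbove ⟨j, hj⟩

theorem minMesh_le_len {j : ℕ} (hj : j < p.N) : p.minMesh ≤ p.len j :=
  ciInf_le (f := fun j : Fin p.N => p.t (j + 1) - p.t j) (finite_range _).bddBelow ⟨j, hj⟩

theorem mesh_pos : 0 < p.mesh := (p.len_pos p.N_pos).trans_le (p.len_le_mesh p.N_pos)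

theorem minMesh_pos : 0 < p.minMesh := by
  have : Nonempty (Fin p.N) := ⟨⟨0, p.N_pos⟩⟩
  obtain ⟨j, hj⟩ := exists_eq_ciInf_of_finite (f := fun j : Fin p.N => p.t (j + 1) - p.t j)
  rw [minMesh, ← hj]
  exact p.len_pos j.2

theorem sum_len (n : ℕ) : ∑ j ∈ Finset.range n, p.len j = p.t n := by
  simp only [len]
  rw [Finset.sum_range_sub, p.t_zero, sub_zero]

theorem len_nonneg {j : ℕ} (hj : j < p.N) : 0 ≤ p.len j := (p.len_pos hj).le

theorem sum_len_sq_le {n : ℕ} (hn : n ≤ p.N) :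
    ∑ j ∈ Finset.range n, p.len j ^ 2 ≤ p.mesh := by
  calc ∑ j ∈ Finset.range n, p.len j ^ 2
      ≤ ∑ j ∈ Finset.range n, p.mesh * p.len j := by
        refine Finset.sum_le_sum fun j hj => ?_
        have hj' : j < p.N := (Finset.mem_range.1 hj).trans_le hn
        rw [sq]
        exact mul_le_mul_of_nonneg_right (p.len_le_mesh hj') (p.len_nonneg hj')
    _ = p.mesh * p.t n := by rw [← Finset.mul_sum, p.sum_len]
    _ ≤ p.mesh := mul_le_of_le_one_right p.mesh_pos.le (p.t_le_one hn)

theorem mesh_le_one : p.mesh ≤ 1 := by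
  have : Nonempty (Fin p.N) := ⟨⟨0, p.N_pos⟩⟩
  refine ciSup_le fun j => ?_
  have h1 := p.t_le_one (j := j + 1) j.2
  have h2 := p.t_nonneg (j := j) j.2.le
  linarith

theorem N_mul_minMesh_le_one : p.N * p.minMesh ≤ 1 := by
  calc (p.N : ℝ) * p.minMesh = ∑ _j ∈ Finset.range p.N, p.minMesh := by simp
    _ ≤ ∑ j ∈ Finset.range p.N, p.len j :=
        Finset.sum_le_sum fun j hj => p.minMesh_le_len (Finset.mem_range.1 hj)
    _ = 1 := by rw [p.sum_len, p.t_last]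

/-- The index of the last point of the partition that is at most `s`. -/
def idx (s : ℝ) : ℕ := by
  classical exact Nat.findGreatest (fun k => p.t k ≤ s) p.N

theorem idx_le (s : ℝ) : p.idx s ≤ p.N := Nat.findGreatest_le _

theorem t_idx_le {s : ℝ} (hs : 0 ≤ s) : p.t (p.idx s) ≤ s := by
  classical
  have h := Nat.findGreatest_spec (P := fun k => p.t k ≤ s) (Nat.zero_le p.N)
    (by rw [p.t_zero]; exact hs)
  simpa only [idx] using h

theorem lt_t_of_idx_lt {s : ℝ} {j : ℕ} (h : p.idx s < j) (hj : j ≤ p.N) : s < p.t j := by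
  classical
  exact not_le.1 (Nat.findGreatest_is_greatest (P := fun k => p.t k ≤ s)
    (by simpa only [idx] using h) hj)

theorem le_idx_iff {s : ℝ} (hs : 0 ≤ s) {j : ℕ} (hj : j ≤ p.N) : j ≤ p.idx s ↔ p.t j ≤ s := by
  constructor
  · intro h
    exact (p.t_le_t h (p.idx_le s)).trans (p.t_idx_le hs)
  · intro h
    by_contra! h'
    exact (p.lt_t_of_idx_lt h' hj).not_ge h

theorem idx_mono {s r : ℝ} (hs : 0 ≤ s) (hsr : s ≤ r) : p.idx s ≤ p.idx r :=
  (p.le_idx_iff (hs.trans hsr) (p.idx_le s)).2 ((p.t_idx_le hs).trans hsr)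

theorem sub_t_idx_le {s : ℝ} (hs : s ∈ Icc (0 : ℝ) 1) : s - p.t (p.idx s) ≤ p.mesh := by
  rcases (p.idx_le s).eq_or_lt with h | h
  · rw [h, p.t_last]
    linarith [hs.2, p.mesh_pos]
  · have h1 := p.lt_t_of_idx_lt (Nat.lt_succ_self _) h
    have h2 := p.len_le_mesh h
    rw [len] at h2
    linarith

theorem t_mem_points {j : ℕ} (hj : j ≤ p.N) : p.t j ∈ p.points := ⟨j, hj, rfl⟩

/-- `φ(v) - φ(u)` times `φ'(v) - φ'(u)` over `v - u`, summed over the partition. -/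
def energy (φ φ' : ℝ → ℝ) : ℝ :=
  ∑ j ∈ Finset.range p.N,
    (φ (p.t (j + 1)) - φ (p.t j)) * (φ' (p.t (j + 1)) - φ' (p.t j)) / (p.t (j + 1) - p.t j)

end UnitPartition


/-! ### Positions of coarse points in the next partition -/

theorem pos_spec {π : ℕ → UnitPartition} (hπ : Refining π) {m k : ℕ} (hk : k ≤ (π m).N) :
    pos π m k ≤ (π (m + 1)).N ∧ (π (m + 1)).t (pos π m k) = (π m).t k := by
  obtain ⟨j, hj, hjt⟩ := hπ m (m + 1) m.le_succ ((π m).t_mem_points hk)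
  have hj' : j ≤ (π (m + 1)).N := hj
  have hne : {j : ℕ | j ≤ (π (m + 1)).N ∧ (π m).t k ≤ (π (m + 1)).t j}.Nonempty :=
    ⟨j, hj', hjt.ge⟩
  have h1 := Nat.sInf_mem hne
  have h2 : pos π m k ≤ j := Nat.sInf_le ⟨hj', hjt.ge⟩
  exact ⟨h1.1, le_antisymm (((π (m + 1)).t_le_t h2 hj').trans hjt.le) h1.2⟩

theorem pos_lt_pos {π : ℕ → UnitPartition} (hπ : Refining π) {m k : ℕ} (hk : k < (π m).N) :
    pos π m k < pos π m (k + 1) := by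
  have h1 := pos_spec hπ hk.le
  have h2 := pos_spec hπ (Nat.succ_le_of_lt hk)
  by_contra! h
  have h3 := (π (m + 1)).t_le_t h h1.1
  have h4 := (π m).t_lt_t (Nat.lt_succ_self k) hk
  rw [h1.2, h2.2] at h3
  exact h3.not_gt h4

theorem pos_zero {π : ℕ → UnitPartition} (m : ℕ) : pos π m 0 = 0 := by
  refine Nat.le_zero.1 (Nat.sInf_le ⟨Nat.zero_le _, ?_⟩)
  rw [(π m).t_zero, (π (m + 1)).t_zero]

theorem pos_N {π : ℕ → UnitPartition} (hπ : Refining π) (m : ℕ) :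
    pos π m (π m).N = (π (m + 1)).N := by
  have h := pos_spec hπ (le_refl (π m).N)
  by_contra h'
  have h2 := (π (m + 1)).t_lt_t (lt_of_le_of_ne h.1 h') le_rfl
  rw [h.2, (π m).t_last, (π (m + 1)).t_last] at h2
  exact lt_irrefl _ h2

theorem sum_range_blocks {f : ℕ → ℝ} {q : ℕ → ℕ} {n : ℕ} (h0 : q 0 = 0)
    (hq : ∀ k < n, q k ≤ q (k + 1)) :
    ∑ k ∈ Finset.range n, ∑ i ∈ Finset.range (q (k + 1) - q k), f (q k + i) =
      ∑ j ∈ Finset.range (q n), f j := by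
  induction n with
  | zero => simp [h0]
  | succ n ih =>
    rw [Finset.sum_range_succ, ih fun k hk => hq k (hk.trans (Nat.lt_succ_self n)),
      ← Finset.sum_range_add, Nat.add_sub_cancel' (hq n (Nat.lt_succ_self n))]

/-! ### Haar coefficients and Parseval's identity -/

/-- The integral of the Haar function with breakpoints `t₁ < t₂ < t₃` against `dφ`. -/
def haarCoeff (t₁ t₂ t₃ : ℝ) (φ : ℝ → ℝ) : ℝ :=
  √((t₃ - t₂) / (t₂ - t₁) * (1 / (t₃ - t₁))) * (φ t₂ - φ t₁) -
    √((t₂ - t₁) / (t₃ - t₂) * (1 / (t₃ - t₁))) * (φ t₃ - φ t₂)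

/-- Step functions on the two cells are spanned by the constant and the Haar function, so the
product is the energy gained by splitting `[t₁, t₃]` at `t₂`. -/
theorem haarCoeff_mul {t₁ t₂ t₃ : ℝ} (h₁ : t₁ < t₂) (h₂ : t₂ < t₃) (φ φ' : ℝ → ℝ) :
    haarCoeff t₁ t₂ t₃ φ * haarCoeff t₁ t₂ t₃ φ' =
      (φ t₂ - φ t₁) * (φ' t₂ - φ' t₁) / (t₂ - t₁) +
      (φ t₃ - φ t₂) * (φ' t₃ - φ' t₂) / (t₃ - t₂) -
      (φ t₃ - φ t₁) * (φ' t₃ - φ' t₁) / (t₃ - t₁) := by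
  have a1 : 0 < t₂ - t₁ := sub_pos.2 h₁
  have a2 : 0 < t₃ - t₂ := sub_pos.2 h₂
  have a3 : 0 < t₃ - t₁ := by linarith
  unfold haarCoeff
  set X := (t₃ - t₂) / (t₂ - t₁) * (1 / (t₃ - t₁)) with hX
  set Y := (t₂ - t₁) / (t₃ - t₂) * (1 / (t₃ - t₁)) with hY
  have hX0 : 0 ≤ X := by positivity
  have hY0 : 0 ≤ Y := by positivity
  have hXX : √X * √X = 1 / (t₂ - t₁) - 1 / (t₃ - t₁) := by
    rw [Real.mul_self_sqrt hX0, hX]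
    field_simp
    ring
  have hYY : √Y * √Y = 1 / (t₃ - t₂) - 1 / (t₃ - t₁) := by
    rw [Real.mul_self_sqrt hY0, hY]
    field_simp
    ring
  have hXY : √X * √Y = 1 / (t₃ - t₁) := by
    rw [← Real.sqrt_mul hX0, show X * Y = (1 / (t₃ - t₁)) ^ 2 by rw [hX, hY]; field_simp]
    exact Real.sqrt_sq (by positivity)
  calc _ = (√X * √X) * ((φ t₂ - φ t₁) * (φ' t₂ - φ' t₁)) +
        (√Y * √Y) * ((φ t₃ - φ t₂) * (φ' t₃ - φ' t₂)) -
        (√X * √Y) * ((φ t₂ - φ t₁) * (φ' t₃ - φ' t₂) + (φ t₃ - φ t₂) * (φ' t₂ - φ' t₁)) := by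
          ring
    _ = _ := by
      rw [hXX, hYY, hXY]
      ring

/-- `haarCoeff` for the Haar function with a given label. -/
def labelCoeff (π : ℕ → UnitPartition) (a : ℕ × ℕ × ℕ) (φ : ℝ → ℝ) : ℝ :=
  haarCoeff ((π (a.1 + 1)).t (pos π a.1 a.2.1)) ((π (a.1 + 1)).t (pos π a.1 a.2.1 + a.2.2 - 1))
    ((π (a.1 + 1)).t (pos π a.1 a.2.1 + a.2.2)) φ

/-- Within one parent interval the `i`-th Haar function compares the union of the first `i - 1`
cells with the next cell. The energies of these growing unions telescope. -/
theorem sum_haarCoeff_mul {τ : ℕ → ℝ} {q : ℕ} (hq : 1 ≤ q)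
    (hτ : ∀ i j, i < j → j ≤ q → τ i < τ j) (φ φ' : ℝ → ℝ) :
    ∑ i ∈ Finset.Icc 2 q,
        haarCoeff (τ 0) (τ (i - 1)) (τ i) φ * haarCoeff (τ 0) (τ (i - 1)) (τ i) φ' =
      ∑ j ∈ Finset.range q,
        (φ (τ (j + 1)) - φ (τ j)) * (φ' (τ (j + 1)) - φ' (τ j)) / (τ (j + 1) - τ j) -
      (φ (τ q) - φ (τ 0)) * (φ' (τ q) - φ' (τ 0)) / (τ q - τ 0) := by
  induction q, hq using Nat.le_induction with
  | base => simp
  | succ q hq ih =>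
    rw [Finset.sum_Icc_succ_top (by omega), ih fun i j hij hj => hτ i j hij (hj.trans q.le_succ),
      Finset.sum_range_succ, Nat.add_sub_cancel,
      haarCoeff_mul (hτ 0 q (by omega) q.le_succ) (hτ q (q + 1) q.lt_succ_self le_rfl)]
    ring

theorem sum_level_labelCoeff_mul {π : ℕ → UnitPartition} (hπ : Refining π) (m : ℕ)
    (φ φ' : ℝ → ℝ) :
    ∑ k ∈ Finset.range (π m).N, ∑ i ∈ Finset.Icc 2 (pos π m (k + 1) - pos π m k),
        labelCoeff π (m, k, i) φ * labelCoeff π (m, k, i) φ' =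
      (π (m + 1)).energy φ φ' - (π m).energy φ φ' := by
  have key : ∀ k ∈ Finset.range (π m).N,
      ∑ i ∈ Finset.Icc 2 (pos π m (k + 1) - pos π m k),
        labelCoeff π (m, k, i) φ * labelCoeff π (m, k, i) φ' =
      ∑ i ∈ Finset.range (pos π m (k + 1) - pos π m k),
        (φ ((π (m + 1)).t (pos π m k + i + 1)) - φ ((π (m + 1)).t (pos π m k + i))) *
          (φ' ((π (m + 1)).t (pos π m k + i + 1)) - φ' ((π (m + 1)).t (pos π m k + i))) /
          ((π (m + 1)).t (pos π m k + i + 1) - (π (m + 1)).t (pos π m k + i)) -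
      (φ ((π m).t (k + 1)) - φ ((π m).t k)) * (φ' ((π m).t (k + 1)) - φ' ((π m).t k)) /
        ((π m).t (k + 1) - (π m).t k) := by
    intro k hk
    have hk' : k < (π m).N := Finset.mem_range.1 hk
    have hlt := pos_lt_pos hπ hk'
    have h1 := pos_spec hπ hk'.le
    have h2 := pos_spec hπ (k := k + 1) hk'
    have := sum_haarCoeff_mul (τ := fun i => (π (m + 1)).t (pos π m k + i))
      (q := pos π m (k + 1) - pos π m k) (by omega)
      (fun i j hij hj => (π (m + 1)).t_lt_t (by omega) (by omega)) φ φ'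
    simp only [add_zero, h1.2, Nat.add_sub_cancel' hlt.le] at this
    simp only [h2.2, ← add_assoc] at this
    rw [← this]
    refine Finset.sum_congr rfl fun i hi => ?_
    have hi2 := (Finset.mem_Icc.1 hi).1
    simp only [labelCoeff, h1.2, Nat.add_sub_assoc (by omega : 1 ≤ i)]
  rw [Finset.sum_congr rfl key, Finset.sum_sub_distrib, UnitPartition.energy,
    UnitPartition.energy]
  congr 1
  rw [← pos_N hπ m]
  exact sum_range_blocks (f := fun j => (φ ((π (m + 1)).t (j + 1)) - φ ((π (m + 1)).t j)) *
          (φ' ((π (m + 1)).t (j + 1)) - φ' ((π (m + 1)).t j)) /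
          ((π (m + 1)).t (j + 1) - (π (m + 1)).t j)) (pos_zero m)
    fun k hk => (pos_lt_pos hπ hk).le

/-- The labels of level `m`. -/
def levelLabels (π : ℕ → UnitPartition) (m : ℕ) : Finset (ℕ × ℕ × ℕ) :=
  (Finset.range (π m).N).biUnion fun k =>
    (Finset.Icc 2 (pos π m (k + 1) - pos π m k)).image fun i => (m, k, i)

/-- The labels of the levels below `n`. -/
def labelsBelow (π : ℕ → UnitPartition) (n : ℕ) : Finset (ℕ × ℕ × ℕ) :=
  (Finset.range n).biUnion (levelLabels π)

theorem mem_levelLabels {π : ℕ → UnitPartition} {m : ℕ} {a : ℕ × ℕ × ℕ} :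
    a ∈ levelLabels π m ↔ a.1 = m ∧ a ∈ labels π := by
  obtain ⟨m', k, i⟩ := a
  simp only [levelLabels, Finset.mem_biUnion, Finset.mem_image, Finset.mem_range,
    Finset.mem_Icc, Prod.mk.injEq, labels, Set.mem_ofPred_eq]
  constructor
  · rintro ⟨k', hk', i', hi', rfl, rfl, rfl⟩
    exact ⟨rfl, hk', hi'.1, hi'.2⟩
  · rintro ⟨rfl, hk, h2, hi⟩
    exact ⟨k, hk, i, ⟨h2, hi⟩, rfl, rfl, rfl⟩

theorem mem_labelsBelow {π : ℕ → UnitPartition} {n : ℕ} {a : ℕ × ℕ × ℕ} :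
    a ∈ labelsBelow π n ↔ a.1 < n ∧ a ∈ labels π := by
  simp [labelsBelow, mem_levelLabels]

theorem sum_levelLabels {π : ℕ → UnitPartition} (m : ℕ) (f : ℕ × ℕ × ℕ → ℝ) :
    ∑ a ∈ levelLabels π m, f a = ∑ k ∈ Finset.range (π m).N,
      ∑ i ∈ Finset.Icc 2 (pos π m (k + 1) - pos π m k), f (m, k, i) := by
  rw [levelLabels, Finset.sum_biUnion]
  · refine Finset.sum_congr rfl fun k _ => ?_
    rw [Finset.sum_image]
    intro i _ j _ h
    simpa using h
  · intro k _ k' _ hkk'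
    simp only [Function.onFun, Finset.disjoint_left, Finset.mem_image]
    rintro _ ⟨i, _, rfl⟩ ⟨j, _, hj⟩
    simp only [Prod.mk.injEq] at hj
    exact hkk' hj.2.1.symm

theorem sum_labelsBelow {π : ℕ → UnitPartition} (n : ℕ) (f : ℕ × ℕ × ℕ → ℝ) :
    ∑ a ∈ labelsBelow π n, f a = ∑ m ∈ Finset.range n, ∑ a ∈ levelLabels π m, f a := by
  rw [labelsBelow, Finset.sum_biUnion]
  intro m _ m' _ hmm'
  simp only [Function.onFun, Finset.disjoint_left, mem_levelLabels]
  rintro a ⟨h1, _⟩ ⟨h2, _⟩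
  exact hmm' (h1.symm.trans h2)

theorem levelLabels_subset {π : ℕ → UnitPartition} (m : ℕ) :
    levelLabels π m ⊆ labelsBelow π (m + 1) := by
  intro a ha
  rw [mem_levelLabels] at ha
  exact mem_labelsBelow.2 ⟨by omega, ha.2⟩

/-- Parseval's identity for the Haar functions of the levels below `n`. -/
theorem parseval {π : ℕ → UnitPartition} (hπ0 : (π 0).N = 1) (hπ : Refining π) (n : ℕ)
    (φ φ' : ℝ → ℝ) :
    ∑ a ∈ labelsBelow π n, labelCoeff π a φ * labelCoeff π a φ' =
      (π n).energy φ φ' - (φ 1 - φ 0) * (φ' 1 - φ' 0) := by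
  rw [sum_labelsBelow]
  simp only [sum_levelLabels, sum_level_labelCoeff_mul hπ]
  rw [Finset.sum_range_sub (fun m => (π m).energy φ φ')]
  congr 1
  -- `π 0` is the single cell `[0, 1]`; its energy is the contribution of the constant function,
  -- which is not in the Haar system.
  have h1 := (π 0).t_last
  rw [hπ0] at h1
  simp [UnitPartition.energy, hπ0, h1, (π 0).t_zero]

/-! ### Schauder functions: values at partition points, Bessel's inequality, covariances -/

theorem label_points {π : ℕ → UnitPartition} (hπ : Refining π) {a : ℕ × ℕ × ℕ}
    (ha : a ∈ labels π) :
    a.2.1 < (π a.1).N ∧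
    (π (a.1 + 1)).t (pos π a.1 a.2.1) = (π a.1).t a.2.1 ∧
    (π (a.1 + 1)).t (pos π a.1 a.2.1) < (π (a.1 + 1)).t (pos π a.1 a.2.1 + a.2.2 - 1) ∧
    (π (a.1 + 1)).t (pos π a.1 a.2.1 + a.2.2 - 1) <
      (π (a.1 + 1)).t (pos π a.1 a.2.1 + a.2.2) ∧
    (π (a.1 + 1)).t (pos π a.1 a.2.1 + a.2.2) ≤ (π a.1).t (a.2.1 + 1) := by
  obtain ⟨m, k, i⟩ := a
  obtain ⟨hk, h2, hi⟩ := ha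
  dsimp only at hk h2 hi ⊢
  have h1 := pos_spec hπ hk.le
  have h3 := pos_spec hπ (k := k + 1) hk
  refine ⟨hk, h1.2, (π (m + 1)).t_lt_t (by omega) (by omega),
    (π (m + 1)).t_lt_t (by omega) (by omega), ?_⟩
  rw [← h3.2]
  exact (π (m + 1)).t_le_t (by omega) h3.1

theorem labelCoeff_sub (π : ℕ → UnitPartition) (a : ℕ × ℕ × ℕ) (φ φ' : ℝ → ℝ) :
    labelCoeff π a (fun r => φ r - φ' r) = labelCoeff π a φ - labelCoeff π a φ' := by
  simp only [labelCoeff, haarCoeff]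
  ring

theorem integral_indicator_Ico {a b t : ℝ} (ha : 0 ≤ a) (hab : a ≤ b) (ht : 0 ≤ t) (c : ℝ) :
    ∫ s in (0 : ℝ)..t, (Ico a b).indicator (fun _ => c) s = c * (min b t - min a t) := by
  rw [intervalIntegral.integral_of_le ht, ← integral_Ico_eq_integral_Ioc,
    setIntegral_indicator measurableSet_Ico, setIntegral_const, Ico_inter_Ico,
    Real.volume_real_Ico, max_eq_right ha, smul_eq_mul, mul_comm]
  congr 1
  rcases le_total a t with h | h
  · rw [min_eq_left h, min_comm b t, max_eq_left]
    exact sub_nonneg.2 (le_min h hab)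
  · rw [min_eq_right h, min_eq_right (h.trans hab), min_eq_left (h.trans hab), sub_self,
      max_eq_right (by linarith)]

/-- On `[0, ∞)` the function `min · t` is a primitive of the indicator of `[0, t)`, so integrating a
Haar function up to `t` is integrating it against `d (min · t)`. -/
theorem schauder_eq {π : ℕ → UnitPartition} (hπ : Refining π) {a : ℕ × ℕ × ℕ}
    (ha : a ∈ labels π) {t : ℝ} (ht : 0 ≤ t) :
    schauder π a.1 a.2.1 a.2.2 t = labelCoeff π a (fun r => min r t) := by
  obtain ⟨hk, h1, h12, h23, -⟩ := label_points hπ ha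
  have h0 : 0 ≤ (π (a.1 + 1)).t (pos π a.1 a.2.1) := by
    rw [h1]; exact (π a.1).t_nonneg hk.le
  simp only [schauder, haar, labelCoeff, haarCoeff]
  rw [intervalIntegral.integral_sub, integral_indicator_Ico h0 h12.le ht,
    integral_indicator_Ico (h0.trans h12.le) h23.le ht]
  all_goals
    rw [intervalIntegrable_iff]
    exact (integrableOn_const (by simp)).indicator measurableSet_Ico

/-- The Schauder function with a given label, evaluated on `[0, 1]`. -/
def schauderAt (π : ℕ → UnitPartition) (a : ℕ × ℕ × ℕ) (t : ℝ) : ℝ :=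
  schauder π a.1 a.2.1 a.2.2 t

theorem schauderSum_eq (π : ℕ → UnitPartition) (θ : ℕ × ℕ × ℕ → ℝ) (n : ℕ) (t : ℝ) :
    schauderSum π θ n t = ∑ a ∈ labelsBelow π n, θ a * schauderAt π a t := by
  rw [sum_labelsBelow]
  simp only [sum_levelLabels, schauderSum, schauderAt]

/-- A Haar function of level `a.1` has mean zero and lives in a single cell of `π a.1`, so its
primitive vanishes at the points of `π a.1` and of every coarser partition. -/
theorem schauderAt_eq_zero {π : ℕ → UnitPartition} (hπ : Refining π) {a : ℕ × ℕ × ℕ}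
    (ha : a ∈ labels π) {n j : ℕ} (hn : n ≤ a.1) (hj : j ≤ (π n).N) :
    schauderAt π a ((π n).t j) = 0 := by
  obtain ⟨l, hl, hlt⟩ := hπ n a.1 hn ((π n).t_mem_points hj)
  have hl' : l ≤ (π a.1).N := hl
  rw [← hlt, schauderAt, schauder_eq hπ ha ((π a.1).t_nonneg hl')]
  obtain ⟨hk, h1, h12, h23, h3⟩ := label_points hπ ha
  simp only [labelCoeff]
  generalize (π (a.1 + 1)).t (pos π a.1 a.2.1) = t₁ at *
  generalize (π (a.1 + 1)).t (pos π a.1 a.2.1 + a.2.2 - 1) = t₂ at *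
  generalize (π (a.1 + 1)).t (pos π a.1 a.2.1 + a.2.2) = t₃ at *
  rcases le_or_gt l a.2.1 with h | h
  · have h5 : (π a.1).t l ≤ t₁ := by rw [h1]; exact (π a.1).t_le_t h hk.le
    simp [haarCoeff, min_eq_right h5, min_eq_right (h5.trans h12.le),
      min_eq_right (h5.trans (h12.le.trans h23.le))]
  · have h5 : t₃ ≤ (π a.1).t l := h3.trans ((π a.1).t_le_t h hl')
    have a1 : 0 < t₂ - t₁ := sub_pos.2 h12
    have a2 : 0 < t₃ - t₂ := sub_pos.2 h23
    have a3 : 0 < t₃ - t₁ := by linarith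
    rw [haarCoeff, min_eq_left h5, min_eq_left (h23.le.trans h5),
      min_eq_left (h12.le.trans (h23.le.trans h5)), sub_eq_zero]
    have hX : 0 ≤ (t₃ - t₂) / (t₂ - t₁) * (1 / (t₃ - t₁)) := by positivity
    have hY : 0 ≤ (t₂ - t₁) / (t₃ - t₂) * (1 / (t₃ - t₁)) := by positivity
    -- Squaring clears the roots from the identity expressing that the Haar function has mean zero.
    refine (pow_left_inj₀ (by positivity) (by positivity) two_ne_zero).1 ?_
    rw [mul_pow, mul_pow, Real.sq_sqrt hX, Real.sq_sqrt hY]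
    field_simp

theorem schauderSum_eq_of_le {π : ℕ → UnitPartition} (hπ : Refining π) (θ : ℕ × ℕ × ℕ → ℝ)
    {n n' j : ℕ} (hn : n ≤ n') (hj : j ≤ (π n).N) :
    schauderSum π θ n' ((π n).t j) = schauderSum π θ n ((π n).t j) := by
  rw [schauderSum_eq, schauderSum_eq]
  refine (Finset.sum_subset (fun a ha => ?_) fun a ha ha' => ?_).symm
  · rw [mem_labelsBelow] at ha ⊢
    exact ⟨ha.1.trans_le hn, ha.2⟩
  · rw [mem_labelsBelow] at ha ha'
    rw [schauderAt_eq_zero hπ ha.2 (by by_contra! h; exact ha' ⟨h, ha.2⟩) hj, mul_zero]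

/-- At a point of `π n` the series stops at level `n`. -/
theorem HasSchauderExpansion.eq_at_point {π : ℕ → UnitPartition} (hπ : Refining π)
    {θ : ℕ × ℕ × ℕ → ℝ} {x : ℝ → ℝ} (hx : HasSchauderExpansion π θ x) {n j : ℕ}
    (hj : j ≤ (π n).N) :
    x ((π n).t j) = x 0 + (x 1 - x 0) * (π n).t j + schauderSum π θ n ((π n).t j) := by
  refine tendsto_nhds_unique (hx _ ((π n).t_mem_Icc hj)) ?_
  refine tendsto_const_nhds.congr' ?_
  filter_upwards [eventually_ge_atTop n] with n' hn'
  rw [schauderSum_eq_of_le hπ θ hn' hj]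

/-- Bessel's inequality for the indicator of `[s, t)`, whose squared norm is `t - s`. Each increment
of its primitive `φ` lies between `0` and the cell length, so the energy is at most the total
increment of `φ`. -/
theorem bessel {π : ℕ → UnitPartition} (hπ0 : (π 0).N = 1) (hπ : Refining π) (n : ℕ)
    {s t : ℝ} (hs : 0 ≤ s) (hst : s ≤ t) (ht : t ≤ 1) :
    ∑ a ∈ labelsBelow π n, (schauderAt π a t - schauderAt π a s) ^ 2 ≤ t - s := by
  set φ : ℝ → ℝ := fun r => min r t - min r s with hφ
  have h1 : ∀ a ∈ labelsBelow π n, (schauderAt π a t - schauderAt π a s) ^ 2 =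
      labelCoeff π a φ * labelCoeff π a φ := by
    intro a ha
    have ha' := (mem_labelsBelow.1 ha).2
    rw [schauderAt, schauderAt, schauder_eq hπ ha' (hs.trans hst), schauder_eq hπ ha' hs,
      ← labelCoeff_sub, sq]
  rw [Finset.sum_congr rfl h1, parseval hπ0 hπ]
  have h2 : (π n).energy φ φ ≤ ∑ j ∈ Finset.range (π n).N,
      (φ ((π n).t (j + 1)) - φ ((π n).t j)) := by
    refine Finset.sum_le_sum fun j hj => ?_
    have hlt := (π n).len_pos (Finset.mem_range.1 hj)
    rw [UnitPartition.len] at hlt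
    rw [div_le_iff₀ hlt]
    refine mul_le_mul_of_nonneg_left ?_ ?_
    · simp only [hφ]
      grind
    · simp only [hφ]
      grind
  rw [Finset.sum_range_sub (fun j => φ ((π n).t j)), (π n).t_zero, (π n).t_last] at h2
  have h3 : φ 1 - φ 0 = t - s := by
    simp [hφ, min_eq_right ht, min_eq_right (hst.trans ht), min_eq_left hs,
      min_eq_left (hs.trans hst)]
  rw [h3] at h2
  linarith [mul_self_nonneg (φ 1 - φ 0)]

/-- The increment over the `j`-th interval of `π n` of a Schauder function. -/
def schauderIncr (π : ℕ → UnitPartition) (n : ℕ) (a : ℕ × ℕ × ℕ) (j : ℕ) : ℝ :=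
  schauderAt π a ((π n).t (j + 1)) - schauderAt π a ((π n).t j)

/-- Indicators of cells of `π n` lie in the span of the constant and the Haar functions below level
`n`, so Parseval is exact for them. The result is the covariance of Brownian bridge increments. -/
theorem sum_schauderIncr_mul {π : ℕ → UnitPartition} (hπ0 : (π 0).N = 1) (hπ : Refining π)
    {n j l : ℕ} (hj : j < (π n).N) (hl : l < (π n).N) :
    ∑ a ∈ labelsBelow π n, schauderIncr π n a j * schauderIncr π n a l =
      (if j = l then (π n).len j else 0) - (π n).len j * (π n).len l := by
  set φ : ℕ → ℝ → ℝ := fun i r => min r ((π n).t (i + 1)) - min r ((π n).t i) with hφ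
  have h1 : ∀ a ∈ labelsBelow π n, ∀ i < (π n).N,
      schauderIncr π n a i = labelCoeff π a (φ i) := by
    intro a ha i hi
    have ha' := (mem_labelsBelow.1 ha).2
    rw [schauderIncr, schauderAt, schauderAt, schauder_eq hπ ha' ((π n).t_nonneg hi),
      schauder_eq hπ ha' ((π n).t_nonneg hi.le), ← labelCoeff_sub]
  have h2 : ∀ i < (π n).N, φ i 1 - φ i 0 = (π n).len i := by
    intro i hi
    simp [hφ, UnitPartition.len, min_eq_right ((π n).t_le_one hi),
      min_eq_right ((π n).t_le_one hi.le), min_eq_left ((π n).t_nonneg hi),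
      min_eq_left ((π n).t_nonneg hi.le)]
  have h3 : ∀ i < (π n).N, ∀ r < (π n).N, φ i ((π n).t (r + 1)) - φ i ((π n).t r) =
      if r = i then (π n).len i else 0 := by
    intro i hi r hr
    simp only [hφ, UnitPartition.len]
    have e1 := (π n).t_lt_t (Nat.lt_succ_self i) hi
    have e2 := (π n).t_lt_t (Nat.lt_succ_self r) hr
    rw [Nat.succ_eq_add_one] at e1 e2
    split_ifs with h
    · subst h
      grind
    · rcases Nat.lt_or_gt_of_ne h with h | h
      · have e3 := (π n).t_le_t (i := r + 1) (j := i) h hi.le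
        grind
      · have e3 := (π n).t_le_t (i := i + 1) (j := r) h hr.le
        grind
  rw [Finset.sum_congr rfl fun a ha => by rw [h1 a ha j hj, h1 a ha l hl],
    parseval hπ0 hπ, h2 j hj, h2 l hl]
  congr 1
  rw [UnitPartition.energy, Finset.sum_congr rfl fun r hr => by
    rw [h3 j hj r (Finset.mem_range.1 hr), h3 l hl r (Finset.mem_range.1 hr)]]
  rw [Finset.sum_eq_single j]
  · have := (π n).len_pos hj
    rw [← UnitPartition.len, if_pos rfl]
    split_ifs with h
    · subst h
      field_simp
    · simp
  · intro r _ hr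
    simp [hr]
  · intro h
    exact absurd (Finset.mem_range.2 hj) h

/-- The factorisation hypothesis involves four distinct labels; an infinite supply lets spare labels
enter with exponent zero. -/
theorem labels_infinite {π : ℕ → UnitPartition} (hπ0 : (π 0).N = 1) (hπ : Refining π)
    (hmesh : Tendsto (fun n => (π n).mesh) atTop (𝓝 0)) : (labels π).Infinite := by
  intro hfin
  -- Only the first cell sees the jump of `φ` at `0`, so the energy is `1 / len 0` and blows up as
  -- the mesh vanishes, whereas finitely many labels would bound it by `B + 1`.
  set φ : ℝ → ℝ := fun r => if r = 0 then 1 else 0 with hφ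
  set B := ∑ a ∈ hfin.toFinset, labelCoeff π a φ * labelCoeff π a φ with hB
  have hB0 : 0 ≤ B := Finset.sum_nonneg fun a _ => mul_self_nonneg _
  have key : ∀ n, 1 / (π n).mesh ≤ B + 1 := by
    intro n
    have h1 : ∑ a ∈ labelsBelow π n, labelCoeff π a φ * labelCoeff π a φ ≤ B :=
      Finset.sum_le_sum_of_subset_of_nonneg
        (fun a ha => hfin.mem_toFinset.2 (mem_labelsBelow.1 ha).2) fun a _ _ => mul_self_nonneg _
    rw [parseval hπ0 hπ] at h1
    have h2 : 1 / (π n).len 0 ≤ (π n).energy φ φ := by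
      have h3 : (0 : ℝ) < (π n).t 1 := by
        simpa [(π n).t_zero] using (π n).t_lt_t zero_lt_one (π n).N_pos
      have h4 : 1 / (π n).len 0 = (φ ((π n).t (0 + 1)) - φ ((π n).t 0)) *
          (φ ((π n).t (0 + 1)) - φ ((π n).t 0)) / ((π n).t (0 + 1) - (π n).t 0) := by
        simp [hφ, UnitPartition.len, (π n).t_zero, h3.ne']
      rw [h4]
      refine Finset.single_le_sum (f := fun j => (φ ((π n).t (j + 1)) - φ ((π n).t j)) *
          (φ ((π n).t (j + 1)) - φ ((π n).t j)) / ((π n).t (j + 1) - (π n).t j))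
        (fun j hj => ?_) (Finset.mem_range.2 (π n).N_pos)
      exact div_nonneg (mul_self_nonneg _) ((π n).len_nonneg (Finset.mem_range.1 hj))
    have h5 : 1 / (π n).mesh ≤ 1 / (π n).len 0 :=
      one_div_le_one_div_of_le ((π n).len_pos (π n).N_pos) ((π n).len_le_mesh (π n).N_pos)
    have h6 : (φ 1 - φ 0) * (φ 1 - φ 0) = 1 := by simp [hφ]
    linarith
  obtain ⟨n, hn⟩ := (hmesh.eventually_lt_const (show (0 : ℝ) < 1 / (B + 2) by positivity)).exists
  have h1 := key n
  have h2 := (π n).mesh_pos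
  rw [div_le_iff₀ h2] at h1
  rw [lt_div_iff₀ (by positivity)] at hn
  nlinarith

/-! ### Moments of linear and quadratic forms in the coefficients -/

/-- The product of two coefficients, minus its expectation. -/
def centredProd {Ω : Type*} (η : ℕ × ℕ × ℕ → Ω → ℝ) (p : (ℕ × ℕ × ℕ) × (ℕ × ℕ × ℕ)) (ω : Ω) : ℝ :=
  η p.1 ω * η p.2 ω - if p.1 = p.2 then 1 else 0

/-- The square of a linear form minus its expectation is the centred quadratic form with a rank-one
kernel. -/
theorem sum_mul_centredProd {Ω : Type*} (η : ℕ × ℕ × ℕ → Ω → ℝ) (s : Finset (ℕ × ℕ × ℕ))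
    (c : ℕ × ℕ × ℕ → ℝ) (ω : Ω) :
    ∑ p ∈ s ×ˢ s, c p.1 * c p.2 * centredProd η p ω =
      (∑ a ∈ s, η a ω * c a) ^ 2 - ∑ a ∈ s, c a ^ 2 := by
  rw [Finset.sum_product, sq, Finset.sum_mul_sum, ← Finset.sum_sub_distrib]
  refine Finset.sum_congr rfl fun a ha => ?_
  have : c a ^ 2 = ∑ b ∈ s, if a = b then c a * c b else 0 := by simp [ha, sq]
  rw [this, ← Finset.sum_sub_distrib]
  refine Finset.sum_congr rfl fun b _ => ?_
  simp only [centredProd]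
  split_ifs <;> ring

namespace AdmissibleCoefficients

variable {Ω : Type*} [MeasurableSpace Ω] {P : Measure Ω} {π : ℕ → UnitPartition}
  {η : ℕ × ℕ × ℕ → Ω → ℝ}

theorem integrable_mul_four (hη : AdmissibleCoefficients P π η)
    {a b c d : ℕ × ℕ × ℕ} (ha : a ∈ labels π) (hb : b ∈ labels π) (hc : c ∈ labels π)
    (hd : d ∈ labels π) : Integrable (fun ω => η a ω * η b ω * (η c ω * η d ω)) P := by
  refine Integrable.mono' ((((hη.integrable_pow_four a ha).add (hη.integrable_pow_four b hb)).add
    (hη.integrable_pow_four c hc)).add (hη.integrable_pow_four d hd))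
    (((hη.aemeasurable a ha).mul (hη.aemeasurable b hb)).mul
      ((hη.aemeasurable c hc).mul (hη.aemeasurable d hd))).aestronglyMeasurable
    (ae_of_all _ fun ω => ?_)
  simp only [Real.norm_eq_abs, Pi.add_apply]
  generalize η a ω = x, η b ω = y, η c ω = z, η d ω = w
  rw [abs_le]
  constructor <;> nlinarith [sq_nonneg (x * y - z * w), sq_nonneg (x * y + z * w),
    sq_nonneg (x ^ 2 - y ^ 2), sq_nonneg (z ^ 2 - w ^ 2), sq_nonneg (x ^ 2), sq_nonneg (y ^ 2),
    sq_nonneg (z ^ 2), sq_nonneg (w ^ 2)]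

theorem integrable_mul [IsProbabilityMeasure P] (hη : AdmissibleCoefficients P π η)
    {a b : ℕ × ℕ × ℕ} (ha : a ∈ labels π) (hb : b ∈ labels π) :
    Integrable (fun ω => η a ω * η b ω) P := by
  refine Integrable.mono' (((hη.integrable_pow_four a ha).add (hη.integrable_pow_four b hb)).add
    (integrable_const 1)) ((hη.aemeasurable a ha).mul (hη.aemeasurable b hb)).aestronglyMeasurable
    (ae_of_all _ fun ω => ?_)
  simp only [Real.norm_eq_abs, Pi.add_apply]
  generalize η a ω = x, η b ω = y
  rw [abs_le]
  constructor <;> nlinarith [sq_nonneg (x - y), sq_nonneg (x + y), sq_nonneg (x ^ 2 - 1),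
    sq_nonneg (y ^ 2 - 1)]

theorem integral_sq (hη : AdmissibleCoefficients P π η) {a : ℕ × ℕ × ℕ} (ha : a ∈ labels π) :
    ∫ ω, η a ω ^ 2 ∂P = 1 := by
  simpa [sq] using hη.orthonormal a ha a ha

variable [IsProbabilityMeasure P]

theorem factorisation_three (hη : AdmissibleCoefficients P π η) (hL : (labels π).Infinite)
    {a b c : ℕ × ℕ × ℕ} (ha : a ∈ labels π) (hb : b ∈ labels π) (hc : c ∈ labels π)
    (hab : a ≠ b) (hac : a ≠ c) (hbc : b ≠ c) {α β γ : ℕ} (h : α + β + γ = 4) :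
    ∫ ω, η a ω ^ α * η b ω ^ β * η c ω ^ γ ∂P =
      (∫ ω, η a ω ^ α ∂P) * (∫ ω, η b ω ^ β ∂P) * (∫ ω, η c ω ^ γ ∂P) := by
  obtain ⟨d, hd, hd'⟩ := hL.exists_notMem_finset {a, b, c}
  simp only [Finset.mem_insert, Finset.mem_singleton, not_or] at hd'
  have := hη.factorisation a ha b hb c hc d hd (by
    simp [hab, hac, hbc, Ne.symm hd'.1, Ne.symm hd'.2.1, Ne.symm hd'.2.2]) α β γ 0 (by omega)
  simpa using this

theorem factorisation_two (hη : AdmissibleCoefficients P π η) (hL : (labels π).Infinite)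
    {a b : ℕ × ℕ × ℕ} (ha : a ∈ labels π) (hb : b ∈ labels π) (hab : a ≠ b)
    {α β : ℕ} (h : α + β = 4) :
    ∫ ω, η a ω ^ α * η b ω ^ β ∂P = (∫ ω, η a ω ^ α ∂P) * (∫ ω, η b ω ^ β ∂P) := by
  obtain ⟨c, hc, hc'⟩ := hL.exists_notMem_finset {a, b}
  simp only [Finset.mem_insert, Finset.mem_singleton, not_or] at hc'
  have := hη.factorisation_three hL ha hb hc hab (Ne.symm hc'.1) (Ne.symm hc'.2)
    (α := α) (β := β) (γ := 0) (by omega)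
  simpa using this

theorem integral_sq_mul_sq (hη : AdmissibleCoefficients P π η) (hL : (labels π).Infinite)
    {a b : ℕ × ℕ × ℕ} (ha : a ∈ labels π) (hb : b ∈ labels π) (hab : a ≠ b) :
    ∫ ω, η a ω ^ 2 * η b ω ^ 2 ∂P = 1 := by
  rw [hη.factorisation_two hL ha hb hab rfl, hη.integral_sq ha, hη.integral_sq hb, one_mul]

theorem integral_cube_mul (hη : AdmissibleCoefficients P π η) (hL : (labels π).Infinite)
    {a b : ℕ × ℕ × ℕ} (ha : a ∈ labels π) (hb : b ∈ labels π) (hab : a ≠ b) :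
    ∫ ω, η a ω ^ 3 * η b ω ∂P = 0 := by
  have := hη.factorisation_two hL ha hb hab (α := 3) (β := 1) rfl
  simpa [hη.centred b hb] using this

theorem integral_sq_mul_mul (hη : AdmissibleCoefficients P π η) (hL : (labels π).Infinite)
    {a b c : ℕ × ℕ × ℕ} (ha : a ∈ labels π) (hb : b ∈ labels π) (hc : c ∈ labels π)
    (hab : a ≠ b) (hac : a ≠ c) (hbc : b ≠ c) :
    ∫ ω, η a ω ^ 2 * η b ω * η c ω ∂P = 0 := by
  have := hη.factorisation_three hL ha hb hc hab hac hbc (α := 2) (β := 1) (γ := 1) rfl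
  simpa [hη.centred b hb] using this

/-- The mixed moments of order four. -/
theorem integral_mul_four (hη : AdmissibleCoefficients P π η) (hL : (labels π).Infinite)
    {a b c d : ℕ × ℕ × ℕ} (ha : a ∈ labels π) (hb : b ∈ labels π) (hc : c ∈ labels π)
    (hd : d ∈ labels π) :
    ∫ ω, η a ω * η b ω * (η c ω * η d ω) ∂P =
      (if a = b then 1 else 0) * (if c = d then 1 else 0) + (if (c, d) = (a, b) then 1 else 0) +
      (if (c, d) = (b, a) then 1 else 0) +
      (if (c, d) = (a, b) ∧ a = b then ∫ ω, η a ω ^ 4 ∂P - 3 else 0) := by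
  simp only [Prod.mk.injEq]
  have cube : ∀ {x y}, x ∈ labels π → y ∈ labels π → x ≠ y → ∀ f : Ω → ℝ,
      (∀ ω, f ω = η x ω ^ 3 * η y ω) → ∫ ω, f ω ∂P = 0 := by
    intro x y hx hy hxy f hf
    rw [← hη.integral_cube_mul hL hx hy hxy]
    exact integral_congr_ae (ae_of_all _ hf)
  have sqm : ∀ {x y z}, x ∈ labels π → y ∈ labels π → z ∈ labels π → x ≠ y → x ≠ z → y ≠ z →
      ∀ f : Ω → ℝ, (∀ ω, f ω = η x ω ^ 2 * η y ω * η z ω) → ∫ ω, f ω ∂P = 0 := by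
    intro x y z hx hy hz hxy hxz hyz f hf
    rw [← hη.integral_sq_mul_mul hL hx hy hz hxy hxz hyz]
    exact integral_congr_ae (ae_of_all _ hf)
  have sqq : ∀ {x y}, x ∈ labels π → y ∈ labels π → x ≠ y → ∀ f : Ω → ℝ,
      (∀ ω, f ω = η x ω ^ 2 * η y ω ^ 2) → ∫ ω, f ω ∂P = 1 := by
    intro x y hx hy hxy f hf
    rw [← hη.integral_sq_mul_sq hL hx hy hxy]
    exact integral_congr_ae (ae_of_all _ hf)
  -- Unless the labels agree in pairs, some label occurs exactly once and its zero mean kills the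
  -- moment. If all four coincide, the three pairings count `3`, which the last term corrects to the
  -- fourth moment.
  rcases eq_or_ne a b with rfl | hab
  · rcases eq_or_ne c d with rfl | hcd
    · rcases eq_or_ne c a with rfl | hca
      · have : ∫ ω, η c ω * η c ω * (η c ω * η c ω) ∂P = ∫ ω, η c ω ^ 4 ∂P :=
          integral_congr_ae (ae_of_all _ fun ω => by dsimp only; ring)
        rw [this]
        simp
        ring
      · rw [sqq ha hc hca.symm _ fun ω => by ring]
        simp [hca]
    · rcases eq_or_ne c a with rfl | hca
      · rw [cube hc hd hcd _ fun ω => by ring]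
        simp [hcd, hcd.symm]
      · rcases eq_or_ne d a with rfl | hda
        · rw [cube hd hc hcd.symm _ fun ω => by ring]
          simp [hcd]
        · rw [sqm ha hc hd hca.symm hda.symm hcd _ fun ω => by ring]
          simp [hcd, hca]
  · rcases eq_or_ne c a with rfl | hca
    · rcases eq_or_ne d b with rfl | hdb
      · rw [sqq ha hb hab _ fun ω => by ring]
        simp [hab]
      · rcases eq_or_ne d c with rfl | hdc
        · rw [cube ha hb hab _ fun ω => by ring]
          simp [hab]
        · rw [sqm hc hb hd hab hdc.symm hdb.symm _ fun ω => by ring]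
          simp [hab, hdb]
    · rcases eq_or_ne c b with rfl | hcb
      · rcases eq_or_ne d a with rfl | hda
        · rw [sqq ha hb hab _ fun ω => by ring]
          simp [hab, hca]
        · rcases eq_or_ne d c with rfl | hdc
          · rw [cube hd ha hda _ fun ω => by ring]
            simp [hab, hca]
          · rw [sqm hc ha hd hca hdc.symm hda.symm _ fun ω => by ring]
            simp [hab, hca, hda]
      · rcases eq_or_ne d a with rfl | hda
        · rw [sqm hd hb hc hab hca.symm hcb.symm _ fun ω => by ring]
          simp [hab, hca, hcb]
        · rcases eq_or_ne d b with rfl | hdb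
          · rw [sqm hd ha hc hda hcb.symm hca.symm _ fun ω => by ring]
            simp [hab, hca, hcb]
          · rcases eq_or_ne d c with rfl | hdc
            · rw [sqm hd ha hb hda hdb hab _ fun ω => by ring]
              simp [hab, hda, hdb]
            · have := hη.factorisation a ha b hb c hc d hd (by
                simp [hab, hca.symm, hcb.symm, hda.symm, hdb.symm, hdc.symm]) 1 1 1 1 rfl
              simp only [pow_one, hη.centred a ha, zero_mul] at this
              have h2 : ∫ ω, η a ω * η b ω * (η c ω * η d ω) ∂P =
                  ∫ ω, η a ω * η b ω * η c ω * η d ω ∂P :=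
                integral_congr_ae (ae_of_all _ fun ω => by dsimp only; ring)
              rw [h2, this]
              simp [hab, hca, hcb]

theorem integrable_centredProd_mul (hη : AdmissibleCoefficients P π η)
    {p q : (ℕ × ℕ × ℕ) × (ℕ × ℕ × ℕ)} (hp : p.1 ∈ labels π ∧ p.2 ∈ labels π)
    (hq : q.1 ∈ labels π ∧ q.2 ∈ labels π) :
    Integrable (fun ω => centredProd η p ω * centredProd η q ω) P := by
  have h := (((hη.integrable_mul_four hp.1 hp.2 hq.1 hq.2).sub
    ((hη.integrable_mul hp.1 hp.2).mul_const (if q.1 = q.2 then 1 else 0))).sub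
    ((hη.integrable_mul hq.1 hq.2).mul_const (if p.1 = p.2 then 1 else 0))).add
    (integrable_const (if p.1 = p.2 then if q.1 = q.2 then (1 : ℝ) else 0 else 0))
  refine h.congr (ae_of_all _ fun ω => ?_)
  simp only [centredProd, Pi.add_apply, Pi.sub_apply]
  split_ifs <;> ring

/-- Centring cancels the pairing of `p.1` with `p.2` and of `q.1` with `q.2`; only the pairings
across `p` and `q` and the correction for four equal labels survive. -/
theorem integral_centredProd_mul (hη : AdmissibleCoefficients P π η) (hL : (labels π).Infinite)
    {p q : (ℕ × ℕ × ℕ) × (ℕ × ℕ × ℕ)} (hp : p.1 ∈ labels π ∧ p.2 ∈ labels π)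
    (hq : q.1 ∈ labels π ∧ q.2 ∈ labels π) :
    ∫ ω, centredProd η p ω * centredProd η q ω ∂P =
      (if q = p then 1 else 0) + (if q = p.swap then 1 else 0) +
      (if q = p ∧ p.1 = p.2 then ∫ ω, η p.1 ω ^ 4 ∂P - 3 else 0) := by
  obtain ⟨a, b⟩ := p
  obtain ⟨c, d⟩ := q
  dsimp only at hp hq
  set δ₁ : ℝ := if a = b then 1 else 0 with h1
  set δ₂ : ℝ := if c = d then 1 else 0 with h2
  have e : ∀ ω, centredProd η (a, b) ω * centredProd η (c, d) ω =
      η a ω * η b ω * (η c ω * η d ω) - η a ω * η b ω * δ₂ - η c ω * η d ω * δ₁ + δ₁ * δ₂ := by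
    intro ω
    simp only [centredProd, ← h1, ← h2]
    ring
  have i1 := hη.integrable_mul_four hp.1 hp.2 hq.1 hq.2
  have i2 := (hη.integrable_mul hp.1 hp.2).mul_const δ₂
  have i3 := (hη.integrable_mul hq.1 hq.2).mul_const δ₁
  have i12 : Integrable (fun ω => η a ω * η b ω * (η c ω * η d ω) - η a ω * η b ω * δ₂) P :=
    i1.sub i2
  have i123 : Integrable (fun ω => η a ω * η b ω * (η c ω * η d ω) - η a ω * η b ω * δ₂ -
    η c ω * η d ω * δ₁) P := i12.sub i3
  rw [integral_congr_ae (ae_of_all _ e), integral_add i123 (integrable_const _),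
    integral_sub i12 i3, integral_sub i1 i2, integral_mul_const, integral_mul_const,
    hη.orthonormal a hp.1 b hp.2, hη.orthonormal c hq.1 d hq.2,
    hη.integral_mul_four hL hp.1 hp.2 hq.1 hq.2, integral_const]
  simp only [← h1, ← h2, Prod.swap, probReal_univ, one_smul]
  ring

/-- The covariance of the centred products couples `p` only to itself and to its swap. A pair of
distinct labels contributes `2 * G p ^ 2`, a diagonal pair its fourth moment minus `1` times `G p ^
2`; both are at most `(M + 2) * G p ^ 2`, as `0 ≤ M`. -/
theorem integral_quadraticForm_sq_le (hη : AdmissibleCoefficients P π η)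
    (hL : (labels π).Infinite) {M : ℝ} (hM : ∀ a ∈ labels π, ∫ ω, η a ω ^ 4 ∂P ≤ M)
    {s : Finset (ℕ × ℕ × ℕ)} (hs : ∀ a ∈ s, a ∈ labels π)
    {G : (ℕ × ℕ × ℕ) × (ℕ × ℕ × ℕ) → ℝ} (hG : ∀ p, G p.swap = G p) :
    Integrable (fun ω => (∑ p ∈ s ×ˢ s, G p * centredProd η p ω) ^ 2) P ∧
    ∫ ω, (∑ p ∈ s ×ˢ s, G p * centredProd η p ω) ^ 2 ∂P ≤
      (M + 2) * ∑ p ∈ s ×ˢ s, G p ^ 2 := by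
  have hmem : ∀ p ∈ s ×ˢ s, p.1 ∈ labels π ∧ p.2 ∈ labels π := fun p hp =>
    ⟨hs _ (Finset.mem_product.1 hp).1, hs _ (Finset.mem_product.1 hp).2⟩
  have e : ∀ ω, (∑ p ∈ s ×ˢ s, G p * centredProd η p ω) ^ 2 =
      ∑ p ∈ s ×ˢ s, ∑ q ∈ s ×ˢ s, G p * G q * (centredProd η p ω * centredProd η q ω) := by
    intro ω
    rw [sq, Finset.sum_mul_sum]
    exact Finset.sum_congr rfl fun p _ => Finset.sum_congr rfl fun q _ => by ring
  have hint : ∀ p ∈ s ×ˢ s, ∀ q ∈ s ×ˢ s,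
      Integrable (fun ω => G p * G q * (centredProd η p ω * centredProd η q ω)) P :=
    fun p hp q hq => (hη.integrable_centredProd_mul (hmem p hp) (hmem q hq)).const_mul _
  simp only [e]
  refine ⟨integrable_finsetSum _ fun p hp => integrable_finsetSum _ (hint p hp), ?_⟩
  rw [integral_finsetSum _ fun p hp => integrable_finsetSum _ (hint p hp), Finset.mul_sum]
  refine Finset.sum_le_sum fun p hp => ?_
  rw [integral_finsetSum _ (hint p hp)]
  have hswap : p.swap ∈ s ×ˢ s := by
    rw [Finset.mem_product] at hp ⊢
    exact hp.symm
  have h1 : ∀ q ∈ s ×ˢ s,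
      ∫ ω, G p * G q * (centredProd η p ω * centredProd η q ω) ∂P =
      (if q = p then G p * G q else 0) + (if q = p.swap then G p * G q else 0) +
      (if q = p then (if p.1 = p.2 then G p * G q * (∫ ω, η p.1 ω ^ 4 ∂P - 3) else 0) else 0) := by
    intro q hq
    rw [integral_const_mul, hη.integral_centredProd_mul hL (hmem p hp) (hmem q hq), ite_and]
    split_ifs <;> ring
  rw [Finset.sum_congr rfl h1, Finset.sum_add_distrib, Finset.sum_add_distrib,
    Finset.sum_ite_eq', Finset.sum_ite_eq', Finset.sum_ite_eq', if_pos hp, if_pos hswap,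
    if_pos hp, hG]
  have h2 := hM p.1 (hmem p hp).1
  have h3 : 0 ≤ ∫ ω, η p.1 ω ^ 4 ∂P := integral_nonneg fun ω => by positivity
  split_ifs
  · nlinarith [mul_le_mul_of_nonneg_left h2 (sq_nonneg (G p)), sq_nonneg (G p)]
  · nlinarith [mul_nonneg (h3.trans h2) (sq_nonneg (G p))]

theorem integral_linearForm_sq (hη : AdmissibleCoefficients P π η)
    {s : Finset (ℕ × ℕ × ℕ)} (hs : ∀ a ∈ s, a ∈ labels π) (c : ℕ × ℕ × ℕ → ℝ) :
    Integrable (fun ω => (∑ a ∈ s, η a ω * c a) ^ 2) P ∧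
      ∫ ω, (∑ a ∈ s, η a ω * c a) ^ 2 ∂P = ∑ a ∈ s, c a ^ 2 := by
  have e : ∀ ω, (∑ a ∈ s, η a ω * c a) ^ 2 =
      ∑ a ∈ s, ∑ b ∈ s, c a * c b * (η a ω * η b ω) := by
    intro ω
    rw [sq, Finset.sum_mul_sum]
    exact Finset.sum_congr rfl fun p _ => Finset.sum_congr rfl fun q _ => by ring
  have hint : ∀ a ∈ s, ∀ b ∈ s, Integrable (fun ω => c a * c b * (η a ω * η b ω)) P :=
    fun a ha b hb => (hη.integrable_mul (hs a ha) (hs b hb)).const_mul _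
  simp only [e]
  refine ⟨integrable_finsetSum _ fun p hp => integrable_finsetSum _ (hint p hp), ?_⟩
  rw [integral_finsetSum _ fun p hp => integrable_finsetSum _ (hint p hp)]
  refine Finset.sum_congr rfl fun a ha => ?_
  rw [integral_finsetSum _ (hint a ha)]
  rw [Finset.sum_congr rfl fun b hb => by
    rw [integral_const_mul, hη.orthonormal a (hs a ha) b (hs b hb)]]
  simp [ha, sq]

theorem integral_linearForm_pow_four_le (hη : AdmissibleCoefficients P π η)
    (hL : (labels π).Infinite) {M : ℝ} (hM : ∀ a ∈ labels π, ∫ ω, η a ω ^ 4 ∂P ≤ M)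
    {s : Finset (ℕ × ℕ × ℕ)} (hs : ∀ a ∈ s, a ∈ labels π) (c : ℕ × ℕ × ℕ → ℝ) :
    Integrable (fun ω => (∑ a ∈ s, η a ω * c a) ^ 4) P ∧
      ∫ ω, (∑ a ∈ s, η a ω * c a) ^ 4 ∂P ≤ (2 * M + 6) * (∑ a ∈ s, c a ^ 2) ^ 2 := by
  obtain ⟨hi, hle⟩ := hη.integral_quadraticForm_sq_le hL hM hs
    (G := fun p => c p.1 * c p.2) (fun p => mul_comm _ _)
  simp only [sum_mul_centredProd] at hi hle
  have hG : ∑ p ∈ s ×ˢ s, (c p.1 * c p.2) ^ 2 = (∑ a ∈ s, c a ^ 2) ^ 2 := by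
    rw [Finset.sum_product, sq (∑ a ∈ s, c a ^ 2), Finset.sum_mul_sum]
    exact Finset.sum_congr rfl fun p _ => Finset.sum_congr rfl fun q _ => by ring
  rw [hG] at hle
  set K := ∑ a ∈ s, c a ^ 2 with hK
  -- With `Y` the linear form, `Y ^ 4 ≤ 2 * (Y ^ 2 - K) ^ 2 + 2 * K ^ 2`; the constant is therefore
  -- `2 * (M + 2) + 2 = 2 * M + 6`.
  have hbound : ∀ ω, (∑ a ∈ s, η a ω * c a) ^ 4 ≤
      2 * ((∑ a ∈ s, η a ω * c a) ^ 2 - K) ^ 2 + 2 * K ^ 2 := fun ω => by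
    nlinarith [sq_nonneg ((∑ a ∈ s, η a ω * c a) ^ 2 - 2 * K)]
  have hi2 : Integrable (fun ω => 2 * ((∑ a ∈ s, η a ω * c a) ^ 2 - K) ^ 2 + 2 * K ^ 2) P :=
    (hi.const_mul 2).add (integrable_const _)
  have hmeas : AEStronglyMeasurable (fun ω => (∑ a ∈ s, η a ω * c a) ^ 4) P :=
    ((Finset.aemeasurable_fun_sum s fun a ha =>
      (hη.aemeasurable a (hs a ha)).mul_const (c a)).pow_const 4).aestronglyMeasurable
  have hi4 : Integrable (fun ω => (∑ a ∈ s, η a ω * c a) ^ 4) P :=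
    hi2.mono' hmeas (ae_of_all _ fun ω => by
      rw [Real.norm_eq_abs, abs_of_nonneg (by positivity)]
      exact hbound ω)
  refine ⟨hi4, ?_⟩
  calc ∫ ω, (∑ a ∈ s, η a ω * c a) ^ 4 ∂P
      ≤ ∫ ω, (2 * ((∑ a ∈ s, η a ω * c a) ^ 2 - K) ^ 2 + 2 * K ^ 2) ∂P :=
        integral_mono hi4 hi2 hbound
    _ = 2 * ∫ ω, ((∑ a ∈ s, η a ω * c a) ^ 2 - K) ^ 2 ∂P + 2 * K ^ 2 := by
        rw [integral_add (hi.const_mul 2) (integrable_const _), integral_const_mul, integral_const]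
        simp
    _ ≤ _ := by nlinarith

end AdmissibleCoefficients

/-! ### Convergence of the quadratic variation at a fixed time -/

/-- The sum of the squared increments of the Schauder series over the intervals of `π n` to the
left of `t`. -/
def bridgeQV (π : ℕ → UnitPartition) (θ : ℕ × ℕ × ℕ → ℝ) (n : ℕ) (t : ℝ) : ℝ :=
  ∑ j ∈ Finset.range ((π n).idx t),
    (schauderSum π θ n ((π n).t (j + 1)) - schauderSum π θ n ((π n).t j)) ^ 2

theorem bridgeQV_mono (π : ℕ → UnitPartition) (θ : ℕ × ℕ × ℕ → ℝ) (n : ℕ) {s t : ℝ}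
    (hs : 0 ≤ s) (hst : s ≤ t) : bridgeQV π θ n s ≤ bridgeQV π θ n t :=
  Finset.sum_le_sum_of_subset_of_nonneg
    (Finset.range_subset_range.2 ((π n).idx_mono hs hst)) fun _ _ _ => sq_nonneg _

theorem schauderSum_incr (π : ℕ → UnitPartition) (θ : ℕ × ℕ × ℕ → ℝ) (n j : ℕ) :
    schauderSum π θ n ((π n).t (j + 1)) - schauderSum π θ n ((π n).t j) =
      ∑ a ∈ labelsBelow π n, θ a * schauderIncr π n a j := by
  simp only [schauderSum_eq, ← Finset.sum_sub_distrib, schauderIncr, mul_sub]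

theorem tendsto_t_idx {p : ℕ → UnitPartition} (hp : Tendsto (fun k => (p k).mesh) atTop (𝓝 0))
    {t : ℝ} (ht : t ∈ Icc (0 : ℝ) 1) :
    Tendsto (fun k => (p k).t ((p k).idx t)) atTop (𝓝 t) := by
  refine tendsto_of_tendsto_of_tendsto_of_le_of_le (g := fun k => t - (p k).mesh) (h := fun _ => t)
    (by simpa using tendsto_const_nhds.sub hp) tendsto_const_nhds (fun k => ?_) fun k => ?_
  · have := (p k).sub_t_idx_le ht
    dsimp only
    linarith
  · exact (p k).t_idx_le ht.1

theorem tendsto_sum_len_sq {p : ℕ → UnitPartition}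
    (hp : Tendsto (fun k => (p k).mesh) atTop (𝓝 0)) (t : ℝ) :
    Tendsto (fun k => ∑ j ∈ Finset.range ((p k).idx t), (p k).len j ^ 2) atTop (𝓝 0) :=
  squeeze_zero (fun _ => Finset.sum_nonneg fun _ _ => sq_nonneg _)
    (fun k => (p k).sum_len_sq_le ((p k).idx_le t)) hp

theorem tendsto_zero_of_sq {f : ℕ → ℝ} (h : Tendsto (fun k => f k ^ 2) atTop (𝓝 0)) :
    Tendsto f atTop (𝓝 0) := by
  rw [tendsto_zero_iff_abs_tendsto_zero]
  have := (Real.continuous_sqrt.tendsto 0).comp h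
  simpa [Function.comp_def, Real.sqrt_sq_eq_abs] using this

/-- By Tonelli the sum of the `f k` has finite expectation, so it is almost surely finite and its
terms tend to zero. The form with `∫⁻` suits the bounds that come from Fatou's lemma. -/
theorem ae_tendsto_zero_of_lintegral_le {Ω : Type*} [MeasurableSpace Ω] {P : Measure Ω}
    {f : ℕ → Ω → ℝ} {b : ℕ → ℝ} (hf : ∀ k, AEMeasurable (f k) P) (hf0 : ∀ k ω, 0 ≤ f k ω)
    (hb0 : ∀ k, 0 ≤ b k) (hb : Summable b)
    (hfb : ∀ k, ∫⁻ ω, ENNReal.ofReal (f k ω) ∂P ≤ ENNReal.ofReal (b k)) :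
    ∀ᵐ ω ∂P, Tendsto (fun k => f k ω) atTop (𝓝 0) := by
  have h1 : ∫⁻ ω, ∑' k, ENNReal.ofReal (f k ω) ∂P ≠ ⊤ := by
    rw [lintegral_tsum fun k => (hf k).ennreal_ofReal]
    refine ne_top_of_le_ne_top ?_ (ENNReal.tsum_le_tsum hfb)
    rw [← ENNReal.ofReal_tsum_of_nonneg hb0 hb]
    exact ENNReal.ofReal_ne_top
  have h2 := ae_lt_top' (AEMeasurable.tsum fun k => (hf k).ennreal_ofReal) h1
  filter_upwards [h2] with ω hω
  have h3 := ENNReal.tendsto_atTop_zero_of_tsum_ne_top hω.ne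
  have h4 := (ENNReal.tendsto_toReal ENNReal.zero_ne_top).comp h3
  simpa [Function.comp_def, ENNReal.toReal_ofReal (hf0 _ ω)] using h4

theorem ae_tendsto_zero_of_integral_le {Ω : Type*} [MeasurableSpace Ω] {P : Measure Ω}
    {f : ℕ → Ω → ℝ} {b : ℕ → ℝ} (hf : ∀ k, Integrable (f k) P) (hf0 : ∀ k ω, 0 ≤ f k ω)
    (hb : Summable b) (hfb : ∀ k, ∫ ω, f k ω ∂P ≤ b k) :
    ∀ᵐ ω ∂P, Tendsto (fun k => f k ω) atTop (𝓝 0) := by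
  refine ae_tendsto_zero_of_lintegral_le (fun k => (hf k).aemeasurable) hf0
    (fun k => (integral_nonneg (hf0 k)).trans (hfb k)) hb fun k => ?_
  rw [← ofReal_integral_eq_lintegral_ofReal (hf k) (ae_of_all _ (hf0 k))]
  exact ENNReal.ofReal_le_ofReal (hfb k)

section Convergence

variable {Ω : Type*} [MeasurableSpace Ω] {P : Measure Ω} [IsProbabilityMeasure P]
  {π : ℕ → UnitPartition} {η : ℕ × ℕ × ℕ → Ω → ℝ}

theorem integral_bridgeQV_sub_sq_le (hπ0 : (π 0).N = 1) (hπ : Refining π)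
    (hL : (labels π).Infinite) (hη : AdmissibleCoefficients P π η)
    {M : ℝ} (hM : ∀ a ∈ labels π, ∫ ω, η a ω ^ 4 ∂P ≤ M) (n : ℕ) (t : ℝ) :
    Integrable (fun ω => (bridgeQV π (fun a => η a ω) n t -
      ∑ j ∈ Finset.range ((π n).idx t), ((π n).len j - (π n).len j ^ 2)) ^ 2) P ∧
    ∫ ω, (bridgeQV π (fun a => η a ω) n t -
      ∑ j ∈ Finset.range ((π n).idx t), ((π n).len j - (π n).len j ^ 2)) ^ 2 ∂P ≤
      2 * (M + 2) * (π n).mesh := by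
  set s := labelsBelow π n with hs
  set J := Finset.range ((π n).idx t) with hJ
  have hJN : ∀ j ∈ J, j < (π n).N := fun j hj =>
    (Finset.mem_range.1 hj).trans_le ((π n).idx_le t)
  have hsl : ∀ a ∈ s, a ∈ labels π := fun a ha => (mem_labelsBelow.1 ha).2
  set G : (ℕ × ℕ × ℕ) × (ℕ × ℕ × ℕ) → ℝ :=
    fun p => ∑ j ∈ J, schauderIncr π n p.1 j * schauderIncr π n p.2 j with hG
  have hM0 : 0 ≤ M := by
    obtain ⟨a, ha⟩ := hL.nonempty
    exact (integral_nonneg fun ω => by positivity).trans (hM a ha)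
  obtain ⟨hi, hle⟩ := hη.integral_quadraticForm_sq_le hL hM hsl (G := G)
    (fun p => Finset.sum_congr rfl fun j _ => mul_comm _ _)
  have e : ∀ ω, ∑ p ∈ s ×ˢ s, G p * centredProd η p ω =
      bridgeQV π (fun a => η a ω) n t - ∑ j ∈ J, ((π n).len j - (π n).len j ^ 2) := by
    intro ω
    simp only [hG, Finset.sum_mul]
    rw [Finset.sum_comm, bridgeQV, ← Finset.sum_sub_distrib]
    refine Finset.sum_congr rfl fun j hj => ?_
    have h1 := sum_schauderIncr_mul hπ0 hπ (hJN j hj) (hJN j hj)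
    rw [sum_mul_centredProd η s (fun a => schauderIncr π n a j), schauderSum_incr, ← hs]
    simp only [sq]
    rw [h1, if_pos rfl]
  simp only [e] at hi hle
  refine ⟨hi, hle.trans ?_⟩
  -- Exchanging sums turns the Hilbert–Schmidt norm of the kernel over labels into that of the
  -- covariance matrix over cells.
  have hGsum : ∑ p ∈ s ×ˢ s, G p ^ 2 = ∑ j ∈ J, ∑ l ∈ J,
      ((if j = l then (π n).len j else 0) - (π n).len j * (π n).len l) ^ 2 := by
    simp only [hG, sq, Finset.sum_mul_sum]
    rw [Finset.sum_comm]
    refine Finset.sum_congr rfl fun j hj => ?_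
    rw [Finset.sum_comm]
    refine Finset.sum_congr rfl fun l hl => ?_
    rw [← sum_schauderIncr_mul hπ0 hπ (hJN j hj) (hJN l hl), Finset.sum_mul_sum,
      Finset.sum_product]
    exact Finset.sum_congr rfl fun a _ => Finset.sum_congr rfl fun b _ => by ring
  have hGle : ∑ p ∈ s ×ˢ s, G p ^ 2 ≤ 2 * (π n).mesh := by
    rw [hGsum]
    -- The cross term of the square is nonpositive on the diagonal and absent off it. With `S` the
    -- sum of squared lengths this leaves `S + S ^ 2`, and `S ≤ mesh ≤ 1`.
    calc _ ≤ ∑ j ∈ J, ∑ l ∈ J,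
          ((if j = l then (π n).len j ^ 2 else 0) + (π n).len j ^ 2 * (π n).len l ^ 2) := by
          refine Finset.sum_le_sum fun j hj => Finset.sum_le_sum fun l hl => ?_
          have h1 := (π n).len_nonneg (hJN j hj)
          have h2 := (π n).len_nonneg (hJN l hl)
          split_ifs
          · nlinarith [mul_nonneg h1 (mul_nonneg h1 h2)]
          · nlinarith
      _ = ∑ j ∈ J, (π n).len j ^ 2 +
            (∑ j ∈ J, (π n).len j ^ 2) * ∑ j ∈ J, (π n).len j ^ 2 := by
          simp only [Finset.sum_add_distrib, Finset.sum_mul_sum]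
          congr 1
          exact Finset.sum_congr rfl fun j hj => by simp [hj]
      _ ≤ 2 * (π n).mesh := by
          have h1 := (π n).sum_len_sq_le ((π n).idx_le t)
          have h2 : 0 ≤ ∑ j ∈ J, (π n).len j ^ 2 := Finset.sum_nonneg fun _ _ => sq_nonneg _
          have h3 := (π n).mesh_le_one
          rw [← hJ] at h1
          nlinarith
  nlinarith

theorem ae_tendsto_bridgeQV (hπ0 : (π 0).N = 1) (hπ : Refining π)
    (hL : (labels π).Infinite) (hη : AdmissibleCoefficients P π η) {ν : ℕ → ℕ}
    (hν : Summable fun k => (π (ν k)).mesh) {t : ℝ} (ht : t ∈ Icc (0 : ℝ) 1) :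
    ∀ᵐ ω ∂P, Tendsto (fun k => bridgeQV π (fun a => η a ω) (ν k) t) atTop (𝓝 t) := by
  obtain ⟨M, hM⟩ := hη.bounded_fourth_moment
  have h := fun k => integral_bridgeQV_sub_sq_le hπ0 hπ hL hη hM (ν k) t
  have hmesh := hν.tendsto_atTop_zero
  filter_upwards [ae_tendsto_zero_of_integral_le (fun k => (h k).1) (fun k ω => sq_nonneg _)
    (hν.mul_left (2 * (M + 2))) fun k => (h k).2] with ω hω
  have h1 : Tendsto (fun k => ∑ j ∈ Finset.range ((π (ν k)).idx t),
      ((π (ν k)).len j - (π (ν k)).len j ^ 2)) atTop (𝓝 t) := by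
    simp only [Finset.sum_sub_distrib, UnitPartition.sum_len]
    simpa using (tendsto_t_idx (p := fun k => π (ν k)) hmesh ht).sub
      (tendsto_sum_len_sq (p := fun k => π (ν k)) hmesh t)
  have h2 := tendsto_zero_of_sq hω
  simpa using h2.add h1

/-- Bessel bounds the second moment of every partial sum by `t - s`, and Fatou passes this to the
limit. Removing the affine part is essential, as `x 0` and `x 1` carry no moment assumption. -/
theorem lintegral_sq_bridge_incr_le (hπ0 : (π 0).N = 1) (hπ : Refining π)
    (hη : AdmissibleCoefficients P π η) {x : ℝ → Ω → ℝ}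
    (hx : ∀ᵐ ω ∂P, HasSchauderExpansion π (fun a => η a ω) (fun t => x t ω)) {s t : ℝ}
    (hs : 0 ≤ s) (hst : s ≤ t) (ht : t ≤ 1) :
    ∫⁻ ω, ENNReal.ofReal ((x t ω - x s ω - (x 1 ω - x 0 ω) * (t - s)) ^ 2) ∂P ≤
      ENNReal.ofReal (t - s) := by
  set F : ℕ → Ω → ℝ := fun n ω =>
    (∑ a ∈ labelsBelow π n, η a ω * (schauderAt π a t - schauderAt π a s)) ^ 2 with hF
  have hmem : ∀ n, ∀ a ∈ labelsBelow π n, a ∈ labels π := fun n a ha => (mem_labelsBelow.1 ha).2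
  have hFi := fun n => hη.integral_linearForm_sq (hmem n)
    fun a => schauderAt π a t - schauderAt π a s
  have hle : ∀ n, ∫⁻ ω, ENNReal.ofReal (F n ω) ∂P ≤ ENNReal.ofReal (t - s) := by
    intro n
    rw [← ofReal_integral_eq_lintegral_ofReal (hFi n).1 (ae_of_all _ fun ω => sq_nonneg _),
      (hFi n).2]
    exact ENNReal.ofReal_le_ofReal (bessel hπ0 hπ n hs hst ht)
  calc ∫⁻ ω, ENNReal.ofReal ((x t ω - x s ω - (x 1 ω - x 0 ω) * (t - s)) ^ 2) ∂P
      = ∫⁻ ω, liminf (fun n => ENNReal.ofReal (F n ω)) atTop ∂P := by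
        refine lintegral_congr_ae ?_
        filter_upwards [hx] with ω hω
        refine (Tendsto.liminf_eq ?_).symm
        refine (ENNReal.continuous_ofReal.tendsto _).comp (Tendsto.pow ?_ 2)
        have h1 := (hω t ⟨hs.trans hst, ht⟩).sub (hω s ⟨hs, hst.trans ht⟩)
        have h2 := h1.sub_const ((x 1 ω - x 0 ω) * (t - s))
        refine h2.congr fun n => ?_
        simp only [schauderSum_eq, mul_sub, Finset.sum_sub_distrib]
        ring
    _ ≤ liminf (fun n => ∫⁻ ω, ENNReal.ofReal (F n ω) ∂P) atTop :=
        lintegral_liminf_le' fun n => (hFi n).1.aemeasurable.ennreal_ofReal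
    _ ≤ ENNReal.ofReal (t - s) :=
        liminf_le_of_le (by isBoundedDefault) fun b hb => by
          obtain ⟨n, hn⟩ := hb.exists
          exact hn.trans (hle n)

theorem ae_tendsto_sub_idx (hπ0 : (π 0).N = 1) (hπ : Refining π)
    (hη : AdmissibleCoefficients P π η) {x : ℝ → Ω → ℝ}
    (hxm : ∀ t ∈ Icc (0 : ℝ) 1, AEMeasurable (x t) P)
    (hx : ∀ᵐ ω ∂P, HasSchauderExpansion π (fun a => η a ω) (fun t => x t ω)) {ν : ℕ → ℕ}
    (hν : Summable fun k => (π (ν k)).mesh) {t : ℝ} (ht : t ∈ Icc (0 : ℝ) 1) :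
    ∀ᵐ ω ∂P, Tendsto (fun k => x t ω - x ((π (ν k)).t ((π (ν k)).idx t)) ω) atTop (𝓝 0) := by
  set τ : ℕ → ℝ := fun k => (π (ν k)).t ((π (ν k)).idx t) with hτ
  have hτt : ∀ k, τ k ≤ t := fun k => (π (ν k)).t_idx_le ht.1
  have hτ0 : ∀ k, τ k ∈ Icc (0 : ℝ) 1 := fun k => (π (ν k)).t_mem_Icc ((π (ν k)).idx_le t)
  have hmesh := hν.tendsto_atTop_zero
  have h1 := (hxm 1 (right_mem_Icc.2 zero_le_one)).sub (hxm 0 (left_mem_Icc.2 zero_le_one))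
  filter_upwards [ae_tendsto_zero_of_lintegral_le
    (f := fun k ω => (x t ω - x (τ k) ω - (x 1 ω - x 0 ω) * (t - τ k)) ^ 2)
    (fun k => (((hxm t ht).sub (hxm _ (hτ0 k))).sub (h1.mul_const (t - τ k))).pow_const 2)
    (fun k ω => sq_nonneg _) (fun k => (π (ν k)).mesh_pos.le) hν fun k =>
      (lintegral_sq_bridge_incr_le hπ0 hπ hη hx (hτ0 k).1 (hτt k) ht.2).trans
        (ENNReal.ofReal_le_ofReal ((π (ν k)).sub_t_idx_le ht))] with ω hω
  have h2 := tendsto_zero_of_sq hω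
  have h3 : Tendsto (fun k => (x 1 ω - x 0 ω) * (t - τ k)) atTop (𝓝 0) := by
    simpa using ((tendsto_const_nhds (x := t)).sub
      (tendsto_t_idx (p := fun k => π (ν k)) hmesh ht)).const_mul (x 1 ω - x 0 ω)
  simpa using h2.add h3

/-- The quadratic variation over the intervals of a partition to the left of `t`. -/
def fullQV (p : UnitPartition) (x : ℝ → ℝ) (t : ℝ) : ℝ :=
  ∑ j ∈ Finset.range (p.idx t), (x (p.t (j + 1)) - x (p.t j)) ^ 2

/-- Cells to the right of `t` have both ends truncated to `t`, so only the cell cut by `t` adds to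
the complete ones. -/
theorem levelQV_eq (p : UnitPartition) (x : ℝ → ℝ) {t : ℝ} (ht : t ∈ Icc (0 : ℝ) 1) :
    levelQV p x t = fullQV p x t + (x t - x (p.t (p.idx t))) ^ 2 := by
  have hlow : ∀ j ≤ p.idx t, min (p.t j) t = p.t j := fun j hj =>
    min_eq_left ((p.le_idx_iff ht.1 (hj.trans (p.idx_le t))).1 hj)
  have hhigh : ∀ j ≤ p.N, p.idx t < j → min (p.t j) t = t := fun j hj hlt =>
    min_eq_right (p.lt_t_of_idx_lt hlt hj).le
  have hfull : ∑ j ∈ Finset.range (p.idx t), (x (min (p.t (j + 1)) t) - x (min (p.t j) t)) ^ 2 =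
      fullQV p x t := by
    refine Finset.sum_congr rfl fun j hj => ?_
    have hj' := Finset.mem_range.1 hj
    rw [hlow j hj'.le, hlow (j + 1) hj']
  rw [levelQV]
  rcases (p.idx_le t).eq_or_lt with h | h
  · have h1 : p.t (p.idx t) = t := by
      have := p.t_idx_le ht.1
      rw [h, p.t_last] at this ⊢
      exact le_antisymm this ht.2
    rw [← hfull, h1, h]
    simp
  · rw [← hfull, ← Finset.sum_range_add_sum_Ico _ h.le]
    congr 1
    rw [Finset.sum_eq_sum_Ico_succ_bot h, hlow _ le_rfl, hhigh _ h (Nat.lt_succ_self _)]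
    rw [Finset.sum_eq_zero fun j hj => ?_, add_zero]
    rw [Finset.mem_Ico] at hj
    rw [hhigh j (by omega) (by omega), hhigh (j + 1) (by omega) (by omega), sub_self]
    simp

/-- For a fixed path the affine part contributes `c ^ 2` times the sum of squared lengths, which
vanishes with the mesh; by Cauchy–Schwarz so does the cross term, the bridge part being convergent.
-/
theorem tendsto_fullQV (hπ : Refining π) {θ : ℕ × ℕ × ℕ → ℝ} {x : ℝ → ℝ}
    (hx : HasSchauderExpansion π θ x) {ν : ℕ → ℕ}
    (hmesh : Tendsto (fun k => (π (ν k)).mesh) atTop (𝓝 0)) {t : ℝ}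
    (h : Tendsto (fun k => bridgeQV π θ (ν k) t) atTop (𝓝 t)) :
    Tendsto (fun k => fullQV (π (ν k)) x t) atTop (𝓝 t) := by
  set c := x 1 - x 0 with hc
  set D : ℕ → ℕ → ℝ := fun k j => schauderSum π θ (ν k) ((π (ν k)).t (j + 1)) -
    schauderSum π θ (ν k) ((π (ν k)).t j) with hD
  have hlen := tendsto_sum_len_sq (p := fun k => π (ν k)) hmesh t
  have e : ∀ k, fullQV (π (ν k)) x t = bridgeQV π θ (ν k) t +
      c ^ 2 * ∑ j ∈ Finset.range ((π (ν k)).idx t), (π (ν k)).len j ^ 2 +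
      2 * c * ∑ j ∈ Finset.range ((π (ν k)).idx t), D k j * (π (ν k)).len j := by
    intro k
    rw [fullQV, bridgeQV, Finset.mul_sum, Finset.mul_sum, ← Finset.sum_add_distrib,
      ← Finset.sum_add_distrib]
    refine Finset.sum_congr rfl fun j hj => ?_
    have hj' := (Finset.mem_range.1 hj).trans_le ((π (ν k)).idx_le t)
    rw [hx.eq_at_point hπ hj'.le, hx.eq_at_point hπ (j := j + 1) hj', UnitPartition.len]
    simp only [hD]
    ring
  have hcross : Tendsto (fun k => ∑ j ∈ Finset.range ((π (ν k)).idx t),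
      D k j * (π (ν k)).len j) atTop (𝓝 0) := by
    refine tendsto_zero_of_sq ?_
    refine squeeze_zero (fun k => sq_nonneg _)
      (fun k => Finset.sum_mul_sq_le_sq_mul_sq _ _ _) ?_
    simpa [bridgeQV] using h.mul hlen
  simp only [e]
  simpa using (h.add (hlen.const_mul (c ^ 2))).add (hcross.const_mul (2 * c))

theorem aemeasurable_levelQV {P : Measure Ω} {x : ℝ → Ω → ℝ} (hxm : ∀ t ∈ Icc (0 : ℝ) 1, AEMeasurable (x t) P)
    (p : UnitPartition) {t : ℝ} (ht : t ∈ Icc (0 : ℝ) 1) :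
    AEMeasurable (fun ω => levelQV p (fun s => x s ω) t) P := by
  refine Finset.aemeasurable_fun_sum _ fun j hj => ?_
  have hj' := Finset.mem_range.1 hj
  exact ((hxm _ ⟨le_min (p.t_nonneg hj') ht.1, (min_le_right _ _).trans ht.2⟩).sub
    (hxm _ ⟨le_min (p.t_nonneg hj'.le) ht.1, (min_le_right _ _).trans ht.2⟩)).pow_const 2

theorem tendsto_levelQV_in_probability (hπ0 : (π 0).N = 1) (hπ : Refining π)
    (hmesh : Tendsto (fun n => (π n).mesh) atTop (𝓝 0)) (hη : AdmissibleCoefficients P π η)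
    {x : ℝ → Ω → ℝ} (hxm : ∀ t ∈ Icc (0 : ℝ) 1, AEMeasurable (x t) P)
    (hx : ∀ᵐ ω ∂P, HasSchauderExpansion π (fun a => η a ω) (fun t => x t ω))
    {t : ℝ} (ht : t ∈ Icc (0 : ℝ) 1) {ε : ℝ} (hε : 0 < ε) :
    Tendsto (fun n => P {ω | ε < |levelQV (π n) (fun s => x s ω) t - t|}) atTop (𝓝 0) := by
  -- Every subsequence has a further one with meshes below `(1 / 2) ^ k`; along it convergence is
  -- almost sure, hence in measure.
  refine tendsto_of_subseq_tendsto fun ns hns => ?_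
  have hm := hmesh.comp hns
  have hex : ∀ k : ℕ, ∃ i, (π (ns i)).mesh < (1 / 2 : ℝ) ^ k := fun k =>
    (hm.eventually_lt_const (by positivity : (0 : ℝ) < (1 / 2 : ℝ) ^ k)).exists
  choose ms hms using hex
  refine ⟨ms, ?_⟩
  have hν : Summable fun k => (π (ns (ms k))).mesh :=
    Summable.of_nonneg_of_le (fun k => (π _).mesh_pos.le) (fun k => (hms k).le)
      (summable_geometric_of_lt_one (by norm_num) (by norm_num))
  have hL := labels_infinite hπ0 hπ hmesh
  have hae : ∀ᵐ ω ∂P, Tendsto (fun k => levelQV (π (ns (ms k))) (fun s => x s ω) t)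
      atTop (𝓝 t) := by
    filter_upwards [hx, ae_tendsto_bridgeQV hπ0 hπ hL hη hν ht,
      ae_tendsto_sub_idx hπ0 hπ hη hxm hx hν ht] with ω h1 h2 h3
    simp only [levelQV_eq _ _ ht]
    simpa using (tendsto_fullQV hπ h1 hν.tendsto_atTop_zero h2).add (h3.pow 2)
  have htm := tendstoInMeasure_of_tendsto_ae
    (fun k => (aemeasurable_levelQV hxm (π (ns (ms k))) ht).aestronglyMeasurable) hae
  rw [tendstoInMeasure_iff_norm] at htm
  refine tendsto_of_tendsto_of_tendsto_of_le_of_le tendsto_const_nhds (htm ε hε)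
    (fun _ => bot_le) fun k => measure_mono fun ω hω => ?_
  exact (show ε < |levelQV (π (ns (ms k))) (fun s => x s ω) t - t| from hω).le

end Convergence

/-! ### Uniform convergence of the series and continuity of the paths -/

/-- The sum of one level of the Schauder series. -/
def levelSum (π : ℕ → UnitPartition) (θ : ℕ × ℕ × ℕ → ℝ) (m : ℕ) (t : ℝ) : ℝ :=
  ∑ a ∈ levelLabels π m, θ a * schauderAt π a t

theorem schauderSum_eq_sum_levelSum (π : ℕ → UnitPartition) (θ : ℕ × ℕ × ℕ → ℝ) (n : ℕ) (t : ℝ) :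
    schauderSum π θ n t = ∑ m ∈ Finset.range n, levelSum π θ m t := by
  rw [schauderSum_eq, sum_labelsBelow]
  rfl

theorem continuousOn_levelSum {π : ℕ → UnitPartition} (hπ : Refining π) (θ : ℕ × ℕ × ℕ → ℝ)
    (m : ℕ) : ContinuousOn (levelSum π θ m) (Icc 0 1) := by
  refine continuousOn_finsetSum _ fun a ha => continuousOn_const.mul ?_
  have h : ContinuousOn (fun t => labelCoeff π a fun r => min r t) (Icc 0 1) := by
    unfold labelCoeff haarCoeff
    fun_prop
  exact h.congr fun t ht => schauder_eq hπ (mem_levelLabels.1 ha).2 ht.1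

/-- Level `m` is affine between consecutive points of `π (m + 1)`, because all breakpoints of its
Haar functions are such points. -/
theorem levelSum_convex_comb {π : ℕ → UnitPartition} (hπ : Refining π) (θ : ℕ × ℕ × ℕ → ℝ)
    {m j : ℕ} (hj : j < (π (m + 1)).N) {t : ℝ} (h1 : (π (m + 1)).t j ≤ t)
    (h2 : t ≤ (π (m + 1)).t (j + 1)) :
    ∃ l : ℝ, 0 ≤ l ∧ l ≤ 1 ∧ levelSum π θ m t =
      (1 - l) * levelSum π θ m ((π (m + 1)).t j) +
        l * levelSum π θ m ((π (m + 1)).t (j + 1)) := by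
  set p := π (m + 1) with hp
  have hlen := p.len_pos hj
  have hle : p.t (j + 1) - p.t j = p.len j := rfl
  refine ⟨(t - p.t j) / p.len j, div_nonneg (sub_nonneg.2 h1) hlen.le,
    (div_le_one hlen).2 (by linarith), ?_⟩
  set l := (t - p.t j) / p.len j with hl
  have hlt : l * p.len j = t - p.t j := div_mul_cancel₀ _ hlen.ne'
  have ht : t = (1 - l) * p.t j + l * p.t (j + 1) := by rw [← hle] at hlt; linarith
  have hmin : ∀ i ≤ p.N,
      min (p.t i) t = (1 - l) * min (p.t i) (p.t j) + l * min (p.t i) (p.t (j + 1)) := by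
    intro i hi
    rcases le_or_gt i j with h | h
    · have e := p.t_le_t h hj.le
      rw [min_eq_left (e.trans h1), min_eq_left e, min_eq_left (e.trans (h1.trans h2))]
      ring
    · have e := p.t_le_t (i := j + 1) h hi
      rw [min_eq_right (h2.trans e), min_eq_right e, min_eq_right ((h1.trans h2).trans e)]
      exact ht
  have h0 : 0 ≤ p.t j := p.t_nonneg hj.le
  simp only [levelSum, Finset.mul_sum, ← Finset.sum_add_distrib]
  refine Finset.sum_congr rfl fun a ha => ?_
  obtain ⟨rfl, hal⟩ := mem_levelLabels.1 ha
  have hpos : pos π a.1 a.2.1 + a.2.2 ≤ p.N := by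
    obtain ⟨hk, _, hi⟩ := hal
    have e1 := (pos_spec hπ (k := a.2.1 + 1) hk).1
    have e2 := pos_lt_pos hπ hk
    rw [← hp] at e1
    omega
  rw [schauderAt, schauderAt, schauderAt, schauder_eq hπ hal (h0.trans h1), schauder_eq hπ hal h0,
    schauder_eq hπ hal (p.t_nonneg hj)]
  simp only [labelCoeff, haarCoeff, ← hp]
  rw [hmin _ hpos, hmin (pos π a.1 a.2.1 + a.2.2 - 1) (by omega),
    hmin (pos π a.1 a.2.1) (by omega)]
  ring

/-- By affinity and convexity of the fourth power, values inside a cell are controlled by the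
endpoints. A supremum over `[0, 1]` thus becomes a finite sum, whose expectation is computable. -/
theorem levelSum_pow_four_le {π : ℕ → UnitPartition} (hπ : Refining π) (θ : ℕ × ℕ × ℕ → ℝ)
    (m : ℕ) {t : ℝ} (ht : t ∈ Icc (0 : ℝ) 1) :
    levelSum π θ m t ^ 4 ≤ ∑ j ∈ Finset.range ((π (m + 1)).N + 1),
      levelSum π θ m ((π (m + 1)).t j) ^ 4 := by
  set p := π (m + 1) with hp
  have hle : ∀ j ≤ p.N, levelSum π θ m (p.t j) ^ 4 ≤
      ∑ j ∈ Finset.range (p.N + 1), levelSum π θ m (p.t j) ^ 4 := fun j hj =>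
    Finset.single_le_sum (f := fun j => levelSum π θ m (p.t j) ^ 4)
      (fun j _ => by positivity) (Finset.mem_range.2 (Nat.lt_succ_of_le hj))
  rcases (p.idx_le t).eq_or_lt with h | h
  · have h1 : p.t p.N = t := by
      have := p.t_idx_le ht.1
      rw [h, p.t_last] at this
      rw [p.t_last]
      exact le_antisymm this ht.2
    have := hle p.N le_rfl
    rwa [h1] at this
  · obtain ⟨l, hl0, hl1, e⟩ := levelSum_convex_comb hπ θ h (p.t_idx_le ht.1)
      (p.lt_t_of_idx_lt (Nat.lt_succ_self _) h).le
    have hc := (Even.convexOn_pow (𝕜 := ℝ) (n := 4) (by decide)).2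
      (mem_univ (levelSum π θ m (p.t (p.idx t))))
      (mem_univ (levelSum π θ m (p.t (p.idx t + 1)))) (sub_nonneg.2 hl1) hl0 (by ring)
    simp only [smul_eq_mul] at hc
    rw [e]
    nlinarith [mul_le_mul_of_nonneg_left (hle _ h.le) (sub_nonneg.2 hl1),
      mul_le_mul_of_nonneg_left (hle _ h) hl0]

/-- Level `m` vanishes at the last point of `π m` before `t`, so only the increment from there to
`t` counts, and Bessel applies. -/
theorem sum_levelLabels_sq_le {π : ℕ → UnitPartition} (hπ0 : (π 0).N = 1) (hπ : Refining π)
    (m : ℕ) {t : ℝ} (ht : t ∈ Icc (0 : ℝ) 1) :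
    ∑ a ∈ levelLabels π m, schauderAt π a t ^ 2 ≤ (π m).mesh := by
  have hs := (π m).idx_le t
  calc ∑ a ∈ levelLabels π m, schauderAt π a t ^ 2
      = ∑ a ∈ levelLabels π m,
          (schauderAt π a t - schauderAt π a ((π m).t ((π m).idx t))) ^ 2 := by
        refine Finset.sum_congr rfl fun a ha => ?_
        obtain ⟨h1, h2⟩ := mem_levelLabels.1 ha
        rw [schauderAt_eq_zero hπ h2 h1.ge hs, sub_zero]
    _ ≤ ∑ a ∈ labelsBelow π (m + 1),
          (schauderAt π a t - schauderAt π a ((π m).t ((π m).idx t))) ^ 2 :=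
        Finset.sum_le_sum_of_subset_of_nonneg (levelLabels_subset m) fun _ _ _ => sq_nonneg _
    _ ≤ t - (π m).t ((π m).idx t) :=
        bessel hπ0 hπ _ ((π m).t_nonneg hs) ((π m).t_idx_le ht.1) ht.2
    _ ≤ (π m).mesh := (π m).sub_t_idx_le ht

theorem CompleteRefining.mesh_le_geometric {π : ℕ → UnitPartition} (h : CompleteRefining π) :
    ∃ q : ℝ, 0 < q ∧ q < 1 ∧ ∀ k, (π (k + 1)).mesh ≤ (q ^ 8) ^ k := by
  obtain ⟨ε, M, hε, -, h⟩ := h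
  -- The eighth root leaves room: a fourth-moment bound of order `q ^ (8 * k)`, divided by the
  -- fourth power of the threshold `q ^ k`, is still the summable `q ^ (4 * k)`.
  set q : ℝ := (1 / (1 + ε)) ^ ((8 : ℝ)⁻¹) with hq
  have h1 : (1 : ℝ) / (1 + ε) < 1 := by
    rw [div_lt_one (by positivity)]
    linarith
  have hq8 : q ^ 8 = 1 / (1 + ε) := by
    have := Real.rpow_inv_natCast_pow (x := 1 / (1 + ε)) (n := 8) (by positivity) (by norm_num)
    simpa [hq] using this
  refine ⟨q, by positivity, Real.rpow_lt_one (by positivity) h1 (by norm_num), fun k => ?_⟩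
  induction k with
  | zero => simpa using (π (0 + 1)).mesh_le_one
  | succ k ih =>
    have h2 := (h (k + 1) (by omega)).1
    rw [le_div_iff₀ (π _).mesh_pos] at h2
    rw [pow_succ]
    calc (π (k + 1 + 1)).mesh ≤ (π (k + 1)).mesh * (1 / (1 + ε)) := by
          rw [mul_one_div, le_div_iff₀ (by positivity)]
          linarith
      _ ≤ _ := by
          rw [hq8] at ih ⊢
          exact mul_le_mul_of_nonneg_right ih (by positivity)

/-- `mesh (k + 1)` is at most `M * mesh (k + 2)`, hence at most `M * c * minMesh (k + 2)`, while `N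
* minMesh ≤ 1`. -/
theorem CompleteRefining.N_mul_mesh_le {π : ℕ → UnitPartition} (h : CompleteRefining π)
    (hb : Balanced π) : ∃ A : ℝ, 0 ≤ A ∧ ∀ k, (π (k + 2)).N * (π (k + 1)).mesh ≤ A := by
  obtain ⟨ε, M, hε, hM, h⟩ := h
  obtain ⟨c, hc, hb⟩ := hb
  refine ⟨M * c, by positivity, fun k => ?_⟩
  have h1 := (h (k + 1) (by omega)).2
  rw [div_le_iff₀ (π _).mesh_pos] at h1
  have h2 := hb (k + 2) (by omega)
  rw [div_le_iff₀ (π _).minMesh_pos] at h2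
  have h3 := (π (k + 2)).N_mul_minMesh_le_one
  have h4 : (0 : ℝ) ≤ (π (k + 2)).N := Nat.cast_nonneg _
  calc ((π (k + 2)).N : ℝ) * (π (k + 1)).mesh
      ≤ (π (k + 2)).N * (M * (c * (π (k + 2)).minMesh)) :=
        mul_le_mul_of_nonneg_left (h1.trans (mul_le_mul_of_nonneg_left h2 hM.le)) h4
    _ = M * c * ((π (k + 2)).N * (π (k + 2)).minMesh) := by ring
    _ ≤ M * c := mul_le_of_le_one_right (by positivity) h3

section Continuity

variable {Ω : Type*} [MeasurableSpace Ω] {P : Measure Ω} [IsProbabilityMeasure P]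
  {π : ℕ → UnitPartition} {η : ℕ × ℕ × ℕ → Ω → ℝ}

/-- At each of the `N + 1` points the fourth moment is at most `(2 * M + 6) * mesh ^ 2`. One factor
`mesh` absorbs the number of points, the other provides `(q ^ 8) ^ k`. -/
theorem ae_eventually_levelSum_le (hπ0 : (π 0).N = 1) (hπ : Refining π)
    (hL : (labels π).Infinite) (hη : AdmissibleCoefficients P π η) (hc : CompleteRefining π)
    (hb : Balanced π) {q : ℝ} (hq0 : 0 < q) (hq1 : q < 1)
    (hq : ∀ k, (π (k + 1)).mesh ≤ (q ^ 8) ^ k) :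
    ∀ᵐ ω ∂P, ∀ᶠ k in atTop, ∀ t ∈ Icc (0 : ℝ) 1,
      ‖levelSum π (fun a => η a ω) (k + 1) t‖ ≤ q ^ k := by
  obtain ⟨M, hM⟩ := hη.bounded_fourth_moment
  obtain ⟨A, hA0, hA⟩ := hc.N_mul_mesh_le hb
  have hM0 : 0 ≤ M := by
    obtain ⟨a, ha⟩ := hL.nonempty
    exact (integral_nonneg fun ω => by positivity).trans (hM a ha)
  have hmom : ∀ m t, Integrable (fun ω => levelSum π (fun a => η a ω) m t ^ 4) P ∧
      ∫ ω, levelSum π (fun a => η a ω) m t ^ 4 ∂P ≤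
        (2 * M + 6) * (∑ a ∈ levelLabels π m, schauderAt π a t ^ 2) ^ 2 :=
    fun m t => hη.integral_linearForm_pow_four_le hL hM
      (fun a ha => (mem_levelLabels.1 ha).2) fun a => schauderAt π a t
  set Z : ℕ → Ω → ℝ := fun k ω => (∑ j ∈ Finset.range ((π (k + 2)).N + 1),
    levelSum π (fun a => η a ω) (k + 1) ((π (k + 2)).t j) ^ 4) / (q ^ k) ^ 4 with hZ
  have hZi : ∀ k, Integrable (Z k) P := fun k =>
    (integrable_finsetSum _ fun j _ => (hmom (k + 1) _).1).div_const _
  have hZle : ∀ k, ∫ ω, Z k ω ∂P ≤ (A + 1) * (2 * M + 6) * (q ^ 4) ^ k := by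
    intro k
    have hm0 := (π (k + 1)).mesh_pos
    have hm1 := (π (k + 1)).mesh_le_one
    rw [hZ, integral_div, div_le_iff₀ (by positivity),
      integral_finsetSum _ fun j _ => (hmom (k + 1) _).1]
    calc _ ≤ ∑ j ∈ Finset.range ((π (k + 2)).N + 1), (2 * M + 6) * (π (k + 1)).mesh ^ 2 := by
          refine Finset.sum_le_sum fun j hj => (hmom (k + 1) _).2.trans ?_
          have hj' : j ≤ (π (k + 2)).N := Nat.lt_succ_iff.1 (Finset.mem_range.1 hj)
          refine mul_le_mul_of_nonneg_left ?_ (by positivity)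
          exact pow_le_pow_left₀ (Finset.sum_nonneg fun _ _ => sq_nonneg _)
            (sum_levelLabels_sq_le hπ0 hπ (k + 1) ((π (k + 2)).t_mem_Icc hj')) 2
      _ = (2 * M + 6) * (((π (k + 2)).N * (π (k + 1)).mesh + (π (k + 1)).mesh) *
            (π (k + 1)).mesh) := by
          rw [Finset.sum_const, Finset.card_range, nsmul_eq_mul]
          push_cast
          ring
      _ ≤ (2 * M + 6) * ((A + 1) * (q ^ 8) ^ k) := by
          refine mul_le_mul_of_nonneg_left ?_ (by positivity)
          exact mul_le_mul (add_le_add (hA k) hm1) (hq k) hm0.le (by positivity)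
      _ = _ := by ring
  have hsum : Summable fun k => (A + 1) * (2 * M + 6) * (q ^ 4) ^ k :=
    (summable_geometric_of_lt_one (by positivity) (pow_lt_one₀ hq0.le hq1 (by norm_num))).mul_left _
  filter_upwards [ae_tendsto_zero_of_integral_le hZi (fun k ω => by positivity) hsum hZle]
    with ω hω
  filter_upwards [hω.eventually_le_const zero_lt_one] with k hk t ht
  simp only [hZ] at hk
  rw [div_le_one (by positivity)] at hk
  have h1 := (levelSum_pow_four_le hπ (fun a => η a ω) (k + 1) ht).trans hk
  rw [Real.norm_eq_abs]
  refine (pow_le_pow_iff_left₀ (abs_nonneg _) (by positivity) (n := 4) (by norm_num)).1 ?_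
  rwa [Even.pow_abs (by decide)]

theorem ae_continuousOn (hπ0 : (π 0).N = 1) (hπ : Refining π)
    (hL : (labels π).Infinite) (hη : AdmissibleCoefficients P π η) (hc : CompleteRefining π)
    (hb : Balanced π) {x : ℝ → Ω → ℝ}
    (hx : ∀ᵐ ω ∂P, HasSchauderExpansion π (fun a => η a ω) (fun t => x t ω)) :
    ∀ᵐ ω ∂P, ContinuousOn (fun t => x t ω) (Icc 0 1) := by
  obtain ⟨q, hq0, hq1, hq⟩ := hc.mesh_le_geometric
  filter_upwards [hx, ae_eventually_levelSum_le hπ0 hπ hL hη hc hb hq0 hq1 hq] with ω h1 h2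
  -- The Weierstrass test applies from level `1` on, where the geometric bound starts; level `0` is
  -- added back separately.
  have hU := tendstoUniformlyOn_tsum_nat_eventually
    (summable_geometric_of_lt_one hq0.le hq1) h2
  have hcont := hU.continuousOn (Eventually.of_forall fun n =>
    continuousOn_finsetSum _ fun k _ => continuousOn_levelSum hπ (fun a => η a ω) (k + 1)).frequently
  have hlin : Continuous fun t : ℝ => x 0 ω + (x 1 ω - x 0 ω) * t := by fun_prop
  refine ((hlin.continuousOn.add (hcont.add (continuousOn_levelSum hπ (fun a => η a ω) 0)))).congr
    fun t ht => ?_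
  refine tendsto_nhds_unique ((tendsto_add_atTop_iff_nat 1).2 (h1 t ht)) ?_
  refine tendsto_const_nhds.add ?_
  simp only [schauderSum_eq_sum_levelSum, Finset.sum_range_succ' _ (_ : ℕ)]
  exact (hU.tendsto_at ht).add_const _

end Continuity

/-! ### Weak convergence of the quadratic variation measures -/

theorem tendsto_of_tendsto_Iic {μs : ℕ → FiniteMeasure (Icc (0 : ℝ) 1)}
    {μ : FiniteMeasure (Icc (0 : ℝ) 1)} (hμ : μ ≠ 0)
    (h : ∀ t, Tendsto (fun n => μs n (Iic t)) atTop (𝓝 (μ (Iic t)))) :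
    Tendsto μs atTop (𝓝 μ) := by
  have huniv : (Iic (1 : Icc (0 : ℝ) 1)) = univ := eq_univ_of_forall fun t => t.2.2
  have hmass : Tendsto (fun n => (μs n).mass) atTop (𝓝 μ.mass) := by
    simpa [huniv] using h 1
  have hmass0 : μ.mass ≠ 0 := (FiniteMeasure.mass_nonzero_iff μ).2 hμ
  have hne : ∀ᶠ n in atTop, μs n ≠ 0 := by
    filter_upwards [hmass.eventually_ne hmass0] with n hn
    exact (FiniteMeasure.mass_nonzero_iff _).1 hn
  have hcdf : ∀ b : ℝ, Tendsto (fun n => μs n (Subtype.val ⁻¹' Iic b)) atTop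
      (𝓝 (μ (Subtype.val ⁻¹' Iic b))) := by
    intro b
    rcases lt_or_ge b 0 with hb | hb
    · have : (Subtype.val ⁻¹' Iic b : Set (Icc (0 : ℝ) 1)) = ∅ :=
        eq_empty_of_forall_notMem fun t ht => (hb.trans_le t.2.1).not_ge ht
      simp [this]
    · have : (Subtype.val ⁻¹' Iic b : Set (Icc (0 : ℝ) 1)) =
          Iic ⟨min b 1, le_min hb zero_le_one, min_le_right _ _⟩ := by
        ext t
        simp only [mem_preimage, mem_Iic, ← Subtype.coe_le_coe, le_min_iff]
        exact ⟨fun h => ⟨h, t.2.2⟩, fun h => h.1⟩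
      rw [this]
      exact h _
  have hIoc : ∀ a b : ℝ, ∀ m : FiniteMeasure (Icc (0 : ℝ) 1), a ≤ b →
      m (Subtype.val ⁻¹' Ioc a b) = m (Subtype.val ⁻¹' Iic b) - m (Subtype.val ⁻¹' Iic a) := by
    intro a b m hab
    have hd : Disjoint (Subtype.val ⁻¹' Iic a : Set (Icc (0 : ℝ) 1)) (Subtype.val ⁻¹' Ioc a b) :=
      (Iic_disjoint_Ioc le_rfl).preimage _
    have hu : (Subtype.val ⁻¹' Iic b : Set (Icc (0 : ℝ) 1)) =
        Subtype.val ⁻¹' Iic a ∪ Subtype.val ⁻¹' Ioc a b := by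
      rw [← preimage_union, Iic_union_Ioc_eq_Iic hab]
    have := measureReal_union (μ := (m : Measure (Icc (0 : ℝ) 1))) hd
      (measurable_subtype_coe measurableSet_Ioc)
    rw [← hu] at this
    simp only [FiniteMeasure.measureReal_eq_coe_coeFn] at this
    have h2 : m (Subtype.val ⁻¹' Iic b) =
      m (Subtype.val ⁻¹' Iic a) + m (Subtype.val ⁻¹' Ioc a b) := by exact_mod_cast this
    rw [h2, add_tsub_cancel_left]
  refine (FiniteMeasure.tendsto_normalize_iff_tendsto hμ).1 ⟨?_, hmass⟩
  -- Half-open intervals form a π-system containing a neighbourhood of each point inside every open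
  -- set. The criterion is for probability measures, which is why `μ ≠ 0` is used to normalise.
  refine IsPiSystem.tendsto_probabilityMeasure_of_tendsto_of_mem
    (S := {s | ∃ a b : ℝ, a ≤ b ∧ s = Subtype.val ⁻¹' Ioc a b}) ?_ ?_ ?_ ?_
  · rintro _ ⟨a, b, hab, rfl⟩ _ ⟨c, d, hcd, rfl⟩ hne
    refine ⟨max a c, min b d, ?_, by rw [← preimage_inter, Ioc_inter_Ioc]⟩
    obtain ⟨t, ⟨h1, h2⟩, h3, h4⟩ := hne
    exact (max_lt h1 h3).le.trans (le_min h2 h4)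
  · rintro _ ⟨a, b, -, rfl⟩
    exact measurable_subtype_coe measurableSet_Ioc
  · intro u hu t ht
    obtain ⟨v, hv, rfl⟩ := isOpen_induced_iff.1 hu
    obtain ⟨ε, hε, hball⟩ := Metric.isOpen_iff.1 hv t ht
    refine ⟨_, ⟨(t : ℝ) - ε / 2, t + ε / 2, by linarith, rfl⟩, ?_, ?_⟩
    · exact continuous_subtype_val.continuousAt.preimage_mem_nhds
        (Ioc_mem_nhds (by linarith) (by linarith))
    · refine preimage_mono (Subset.trans (fun r hr => ?_) hball)
      rw [Metric.mem_ball, Real.dist_eq, abs_lt]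
      constructor <;> linarith [hr.1, hr.2]
  · rintro _ ⟨a, b, hab, rfl⟩
    rw [FiniteMeasure.normalize_eq_of_nonzero _ hμ]
    have h1 := (hmass.inv₀ hmass0).mul ((hcdf b).sub (hcdf a))
    rw [← hIoc a b μ hab] at h1
    refine h1.congr' ?_
    filter_upwards [hne] with n hn
    rw [FiniteMeasure.normalize_eq_of_nonzero _ hn, hIoc a b _ hab]

/-- The atom of a cell sits at its left end, so `Iic t` counts the whole cell containing `t`. At `t
= 1` there is no such cell, and the `min` makes the extra term zero. -/
theorem qvMeasure_Iic (p : UnitPartition) (x : ℝ → ℝ) (t : Icc (0 : ℝ) 1) :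
    (qvMeasure p x (Iic t) : ℝ) = fullQV p x t +
      (x (p.t (min (p.idx t + 1) p.N)) - x (p.t (p.idx t))) ^ 2 := by
  have hsum : ∀ n ≤ p.N, ((∑ j ∈ Finset.range n,
      Real.toNNReal ((x (p.t (j + 1)) - x (p.t j)) ^ 2) •
        (diracProba (projIcc (0 : ℝ) 1 zero_le_one (p.t j))).toFiniteMeasure :
          FiniteMeasure (Icc (0 : ℝ) 1)) (Iic t) : ℝ) =
      ∑ j ∈ Finset.range n, if j ≤ p.idx t then (x (p.t (j + 1)) - x (p.t j)) ^ 2 else 0 := by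
    intro n hn
    induction n with
    | zero => simp
    | succ n ih =>
      rw [Finset.sum_range_succ, Finset.sum_range_succ, FiniteMeasure.coeFn_add, Pi.add_apply,
        NNReal.coe_add, ih (by omega), FiniteMeasure.smul_apply]
      congr 1
      have hmem : projIcc (0 : ℝ) 1 zero_le_one (p.t n) ∈ Iic t ↔ n ≤ p.idx t := by
        rw [projIcc_of_mem _ (p.t_mem_Icc (by omega : n ≤ p.N)), mem_Iic, ← Subtype.coe_le_coe,
          p.le_idx_iff t.2.1 (by omega)]
      rw [FiniteMeasure.coeFn_def]
      simp only [ProbabilityMeasure.toMeasure_comp_toFiniteMeasure_eq_toMeasure,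
        diracProba_toMeasure_apply, indicator_apply, hmem]
      split_ifs <;> simp [sq_nonneg]
  rw [qvMeasure, hsum p.N le_rfl, fullQV]
  rcases (p.idx_le t).eq_or_lt with h | h
  · rw [h, min_eq_right (Nat.le_succ _), sub_self]
    simp only [ne_eq, OfNat.ofNat_ne_zero, not_false_eq_true, zero_pow, add_zero]
    exact Finset.sum_congr rfl fun j hj => if_pos (Finset.mem_range.1 hj).le
  · rw [min_eq_left (Nat.succ_le_of_lt h), ← Finset.sum_range_add_sum_Ico _ h.le,
      Finset.sum_eq_sum_Ico_succ_bot h, if_pos le_rfl,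
      Finset.sum_eq_zero (s := Finset.Ico _ _) fun j hj => ?_, add_zero]
    · congr 1
      exact Finset.sum_congr rfl fun j hj => if_pos (Finset.mem_range.1 hj).le
    · exact if_neg (by rw [Finset.mem_Ico] at hj; omega)

theorem tendsto_t_succ_idx {p : ℕ → UnitPartition}
    (hp : Tendsto (fun k => (p k).mesh) atTop (𝓝 0)) {t : ℝ} (ht : t ∈ Icc (0 : ℝ) 1) :
    Tendsto (fun k => (p k).t (min ((p k).idx t + 1) (p k).N)) atTop (𝓝 t) := by
  have h1 := tendsto_t_idx hp ht
  refine tendsto_of_tendsto_of_tendsto_of_le_of_le h1 (by simpa using h1.add hp)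
    (fun k => ?_) fun k => ?_
  · exact (p k).t_le_t (le_min (Nat.le_succ _) ((p k).idx_le t)) (min_le_right _ _)
  · rcases ((p k).idx_le t).eq_or_lt with h | h
    · dsimp only
      rw [h, min_eq_right (Nat.le_succ _)]
      linarith [(p k).mesh_pos]
    · have := (p k).len_le_mesh h
      rw [UnitPartition.len] at this
      dsimp only
      rw [min_eq_left (Nat.succ_le_of_lt h)]
      linarith

/-- Monotone functions are squeezed between their values at nearby rationals, and the limit is
continuous. The ends `0` and `1` are rational themselves and are treated apart. -/
theorem tendsto_of_monotone_of_rat {F : ℕ → ℝ → ℝ}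
    (hmono : ∀ n s t, 0 ≤ s → s ≤ t → F n s ≤ F n t)
    (h : ∀ r : ℚ, (r : ℝ) ∈ Icc (0 : ℝ) 1 → Tendsto (fun n => F n r) atTop (𝓝 r))
    {t : ℝ} (ht : t ∈ Icc (0 : ℝ) 1) : Tendsto (fun n => F n t) atTop (𝓝 t) := by
  rw [tendsto_order]
  constructor
  · intro a ha
    rcases ht.1.eq_or_lt with h0 | h0
    · subst h0
      have := h 0 (by simp)
      rw [Rat.cast_zero] at this
      exact this.eventually_const_lt ha
    · obtain ⟨r, hr1, hr2⟩ := exists_rat_btwn (max_lt ha h0)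
      have hr0 : (0 : ℝ) ≤ r := (le_max_right a 0).trans hr1.le
      filter_upwards [(h r ⟨hr0, hr2.le.trans ht.2⟩).eventually_const_lt
        ((le_max_left a 0).trans_lt hr1)] with n hn
      exact hn.trans_le (hmono n r t hr0 hr2.le)
  · intro a ha
    rcases ht.2.eq_or_lt with h1 | h1
    · subst h1
      have := h 1 (by simp)
      rw [Rat.cast_one] at this
      exact this.eventually_lt_const ha
    · obtain ⟨r, hr1, hr2⟩ := exists_rat_btwn (lt_min ha h1)
      filter_upwards [(h r ⟨ht.1.trans hr1.le, hr2.le.trans (min_le_right _ _)⟩).eventually_lt_const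
        (hr2.trans_le (min_le_left _ _))] with n hn
      exact (hmono n t r ht.1 hr1.le).trans_lt hn

theorem isCadlag_of_continuousOn {x : ℝ → ℝ} (hx : ContinuousOn x (Icc 0 1)) : IsCadlag x := by
  constructor
  · intro t ht
    exact (hx t ⟨ht.1, ht.2.le⟩).mono_left (nhdsWithin_le_of_mem
      (mem_of_superset (Ioo_mem_nhdsGT ht.2) fun s hs => ⟨ht.1.trans hs.1.le, hs.2.le⟩))
  · intro t ht
    exact ⟨x t, (hx t ⟨ht.1.le, ht.2⟩).mono_left (nhdsWithin_le_of_mem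
      (mem_of_superset (Ioo_mem_nhdsLT ht.1) fun s hs => ⟨hs.1.le, hs.2.le.trans ht.2⟩))⟩

theorem jump_eq_zero_of_continuousOn {x : ℝ → ℝ} (hx : ContinuousOn x (Icc 0 1)) {t : ℝ}
    (ht : t ∈ Ioc (0 : ℝ) 1) : jump x t = 0 := by
  have h : Tendsto x (𝓝[<] t) (𝓝 (x t)) :=
    (hx t ⟨ht.1.le, ht.2⟩).mono_left (nhdsWithin_le_of_mem
      (mem_of_superset (Ioo_mem_nhdsLT ht.1) fun s hs => ⟨hs.1.le, hs.2.le.trans ht.2⟩))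
  rw [jump, leftLim_eq_of_tendsto h, sub_self]

theorem hasQuadraticVariation_of_tendsto_fullQV {π : ℕ → UnitPartition} {x : ℝ → ℝ}
    (hmesh : Tendsto (fun n => (π n).mesh) atTop (𝓝 0)) (hx : ContinuousOn x (Icc 0 1))
    (h : ∀ t ∈ Icc (0 : ℝ) 1, Tendsto (fun n => fullQV (π n) x t) atTop (𝓝 t)) :
    HasQuadraticVariation π x fun t => t := by
  -- The limit measure is Lebesgue measure, whose distribution function is the identity.
  set μ : FiniteMeasure (Icc (0 : ℝ) 1) := ⟨volume, inferInstance⟩ with hμdef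
  have hμ : ∀ t : Icc (0 : ℝ) 1, (μ (Iic t) : ℝ) = t := by
    intro t
    rw [FiniteMeasure.coeFn_def, hμdef]
    have := unitInterval.volume_Iic t
    change (((volume : Measure (Icc (0 : ℝ) 1)) (Iic t)).toNNReal : ℝ) = t
    rw [this]
    exact ENNReal.toReal_ofReal t.2.1
  have hμ0 : μ ≠ 0 := by
    intro h0
    have := hμ 1
    simp [h0] at this
  have hx1 : ∀ t ∈ Icc (0 : ℝ) 1,
      Tendsto (fun n => x ((π n).t ((π n).idx t))) atTop (𝓝 (x t)) := fun t ht =>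
    (hx t ht).tendsto.comp (tendsto_nhdsWithin_iff.2 ⟨tendsto_t_idx hmesh ht,
      Eventually.of_forall fun n => (π n).t_mem_Icc ((π n).idx_le t)⟩)
  have hx2 : ∀ t ∈ Icc (0 : ℝ) 1,
      Tendsto (fun n => x ((π n).t (min ((π n).idx t + 1) (π n).N))) atTop (𝓝 (x t)) :=
    fun t ht => (hx t ht).tendsto.comp (tendsto_nhdsWithin_iff.2 ⟨tendsto_t_succ_idx hmesh ht,
      Eventually.of_forall fun n => (π n).t_mem_Icc (min_le_right _ _)⟩)
  have hjump : ∀ t : Icc (0 : ℝ) 1, ∑' s : Ioc (0 : ℝ) (t : ℝ), jump x s ^ 2 = 0 := by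
    intro t
    refine (tsum_congr fun s => ?_).trans tsum_zero
    rw [jump_eq_zero_of_continuousOn hx ⟨s.2.1, s.2.2.trans t.2.2⟩]
    simp
  refine ⟨isCadlag_of_continuousOn hx, μ, ?_, ?_, ?_, ?_, fun t => ⟨(hμ t).symm, ?_⟩⟩
  · refine tendsto_of_tendsto_Iic hμ0 fun t => NNReal.tendsto_coe.1 ?_
    simp only [qvMeasure_Iic, hμ]
    simpa using (h t t.2).add (((hx2 t t.2).sub (hx1 t t.2)).pow 2)
  · refine summable_zero.congr fun s => ?_
    rw [jump_eq_zero_of_continuousOn hx s.2]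
    simp
  · simp only [hjump, hμ, sub_zero]
    exact continuous_subtype_val
  · simp only [hjump, hμ, sub_zero]
    exact fun s t hst => hst
  · simp only [levelQV_eq _ _ t.2]
    simpa using (h t t.2).add (((tendsto_const_nhds (x := x t)).sub (hx1 t t.2)).pow 2)

/-- The exceptional null set depends on the time, so almost sure convergence is taken at the
countably many rational times and then extended by monotonicity of `bridgeQV`. -/
theorem ae_hasQuadraticVariation {Ω : Type*} [MeasurableSpace Ω] {P : Measure Ω}
    [IsProbabilityMeasure P] {π : ℕ → UnitPartition} {η : ℕ × ℕ × ℕ → Ω → ℝ}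
    (hπ0 : (π 0).N = 1) (hπ : Refining π)
    (hmesh : Tendsto (fun n => (π n).mesh) atTop (𝓝 0)) (hη : AdmissibleCoefficients P π η)
    (hc : CompleteRefining π) (hb : Balanced π) {x : ℝ → Ω → ℝ}
    (hx : ∀ᵐ ω ∂P, HasSchauderExpansion π (fun a => η a ω) (fun t => x t ω)) :
    ∀ᵐ ω ∂P, HasQuadraticVariation π (fun t => x t ω) fun t => t := by
  have hL := labels_infinite hπ0 hπ hmesh
  obtain ⟨q, hq0, hq1, hq⟩ := hc.mesh_le_geometric
  have hsum : Summable fun n => (π n).mesh := by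
    rw [← summable_nat_add_iff 1]
    exact Summable.of_nonneg_of_le (fun k => (π _).mesh_pos.le) hq
      (summable_geometric_of_lt_one (by positivity) (pow_lt_one₀ hq0.le hq1 (by norm_num)))
  have hrat : ∀ᵐ ω ∂P, ∀ r : ℚ, (r : ℝ) ∈ Icc (0 : ℝ) 1 →
      Tendsto (fun n => bridgeQV π (fun a => η a ω) n r) atTop (𝓝 r) := by
    rw [ae_all_iff]
    intro r
    by_cases hr : (r : ℝ) ∈ Icc (0 : ℝ) 1
    · filter_upwards [ae_tendsto_bridgeQV hπ0 hπ hL hη (ν := fun n => n) hsum hr] with ω hω _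
      exact hω
    · exact ae_of_all _ fun ω h => absurd h hr
  filter_upwards [hx, hrat, ae_continuousOn hπ0 hπ hL hη hc hb hx] with ω h1 h2 h3
  refine hasQuadraticVariation_of_tendsto_fullQV hmesh h3 fun t ht => ?_
  exact tendsto_fullQV hπ h1 (ν := fun n => n) hmesh
    (tendsto_of_monotone_of_rat (fun n s t => bridgeQV_mono π _ n) h2 ht)

end SchauderQV

end

theorem mainTheorem2 {Ω : Type*} [MeasurableSpace Ω] (P : Measure Ω) [IsProbabilityMeasure P]
    (π : ℕ → SchauderQV.UnitPartition) (hπ0 : (π 0).N = 1)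
    (hπ : SchauderQV.FinitelyRefining π)
    (η : ℕ × ℕ × ℕ → Ω → ℝ) (hη : SchauderQV.AdmissibleCoefficients P π η)
    (x : ℝ → Ω → ℝ) (hx_meas : ∀ t ∈ Set.Icc (0 : ℝ) 1, AEMeasurable (x t) P)
    (hx : ∀ᵐ ω ∂P, SchauderQV.HasSchauderExpansion π (fun a => η a ω) (fun t => x t ω)) :
    (∀ t ∈ Set.Icc (0 : ℝ) 1, ∀ ε : ℝ, 0 < ε →
      Tendsto (fun n => P {ω | ε < |SchauderQV.levelQV (π n) (fun s => x s ω) t - t|})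
        atTop (𝓝 0)) ∧
    (SchauderQV.CompleteRefining π → SchauderQV.Balanced π →
      ∀ᵐ ω ∂P, (fun t => x t ω) ∈ SchauderQV.finiteQV π ∧
        SchauderQV.HasQuadraticVariation π (fun t => x t ω) (fun t => t)) := by
  refine ⟨fun t ht ε hε => SchauderQV.tendsto_levelQV_in_probability hπ0 hπ.1 hπ.2.1 hη hx_meas
    hx ht hε, fun hc hb => ?_⟩
  filter_upwards [SchauderQV.ae_hasQuadraticVariation hπ0 hπ.1 hπ.2.1 hη hc hb hx] with ω hω
  exact ⟨⟨_, hω⟩, hω⟩
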